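/- Let $k$ be a non-archimedean local field (for example a completion $k_v$ of a number field) with ring of integers $\mathfrak o$, maximal ideal $(\varpi)$, residue field of cardinality $q$, and normalized absolute value $|\cdot|$, so $|\varpi|=q^{-1}$. Let $n\ge 0$, and let $S$ be a symmetric $(n+1)\times(n+1)$ matrix over $k$, $B(a)=aSa^{t}$. Assume the place is good: $2$ and $\det S$ are units. Equip the space of row vectors $k^{n+3}=(k e_+)\oplus k^{n+1}\oplus(k e_-)$ with the quadratic form for which this decomposition is orthogonal, $\langle e_+,e_+\rangle=1$, $\langle a,a\rangle=B(a)$, $\langle e_-,e_-\rangle=-1$, and let $G=\mathrm O(n+3)$ be its isometry group, acting on the right. Put $e=e_++e_-$ and $e'=\frac12(e_+-e_-)$. Let $P\subset G$ be the parabolic subgroup stabilizing the line $ke$, $N$ its unipotent radical, and $M\subset P$ the Levi component stabilizing $k^{n+1}=\{e_+,e_-\}^\perp$; for $m\in M$ define $\lambda\in k^\times$ by $e\cdot m=e/\lambda$. Let $\xi\in G$ represent the long Weyl element, with $e\xi=e'$ and $e'\xi=e$. Let $\Phi$ be the characteristic function of $\mathfrak o^{n+3}$, and for $s\in\mathbb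 C$ with $\operatorname{Re}s>0$ and $\alpha=(n+1)s$ put $$\varphi(g)=\int_{k^\times}|t|^{\alpha}\,\Phi(te\cdot g)\,d^\times t,\qquad \varphi^\circ(g)=\frac{\varphi(g)}{\varphi(1)}\qquad(g\in G),$$ the local component of the normalized spherical vector defining the spherical Eisenstein series. Here $d^\times t$ is the Haar measure on $k^\times$ giving $\mathfrak o^\times$ volume $1$. Let $da$ be the Haar measure on $k^{n+1}$ giving $\mathfrak o^{n+1}$ volume $1$, and $dn$ the corresponding Haar measure on $N$ under the identification of $N$ with $k^{n+1}$ that sends $u\in N$ to the $k^{n+1}$-component $a$ of $e'\cdot u=e'+a-\frac12B(a)e$. Set $$X^{n+1}_\ell(0)=\operatorname{meas}\{a\in\mathfrak o^{n+1}: B(a)\equiv 0 \bmod \varpi^\ell\},\qquad X^{n+1}(\beta;0)=\sum_{\ell\ge0}q^{-\beta\ell}X^{n+1}_\ell(0),\qquad Z(\alpha)=\frac1{1-q^{-\alpha}}.$$ Then, for every $m\in M$ with parameter $\lambda$ as above, the integral $\int_N\varphi^\circ(\xi nm)\,dn$ (the local factor at this place of the nontrivial part of the constant term of the spherical Eisenstein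 series) converges absolutely if and only if the series $X^{n+1}(-(n+1)(1-s);0)$ does; both converge when $\operatorname{Re}s>1$; and whenever they converge $$\int_N\varphi^\circ(\xi nm)\,dn=|\lambda|^{(n+1)(1-s)}\cdot\frac{X^{n+1}\bigl(-(n+1)(1-s);0\bigr)}{Z\bigl((n+1)s\bigr)}.$$ -/

import Mathlib

open MeasureTheory
open scoped Matrix Valued NormedField

/-!
The local setting.  `k` is a non-archimedean local field with its absolute value `‖·‖`, ring of
integers `𝒪[k]`, maximal ideal `𝓂[k]` and residue field `𝓀[k]`.  The quadratic space is
`k^{m+2} = (k · e₊) ⊕ k^m ⊕ (k · e₋)`, an orthogonal sum with `⟨e₊, e₊⟩ = 1`, `⟨e₋, e₋⟩ = -1` and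
`⟨a, a⟩ = B(a) = a S aᵗ` on `k^m`, for a symmetric matrix `S`.  Vectors are rows and groups act
on the right.
-/

namespace OrthConst

/-- The number `q` of elements of the residue field. -/
noncomputable def residueCard (k : Type*) [NontriviallyNormedField k] [IsUltrametricDist k] : ℕ :=
  Nat.card 𝓀[k]

/-- Coordinates of `k^{m+2}`: first `e₊`, then `k^m`, then `e₋`. -/
abbrev Idx (m : ℕ) : Type := Unit ⊕ Fin m ⊕ Unit

section Group

variable {k : Type*} [Field k] {m : ℕ}

/-- The quadratic form `B(a) = a S aᵗ` on `k^m`. -/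
def quadForm (S : Matrix (Fin m) (Fin m) k) (a : Fin m → k) : k := a ⬝ᵥ (S *ᵥ a)

/-- The Gram matrix `diag(1, S, -1)` of the form on `k^{m+2}`. -/
def gram (S : Matrix (Fin m) (Fin m) k) : Matrix (Idx m) (Idx m) k :=
  Matrix.fromBlocks 1 0 0 (Matrix.fromBlocks S 0 0 (-1))

/-- The bilinear form `⟨v, w⟩` on `k^{m+2}`. -/
def pairing (S : Matrix (Fin m) (Fin m) k) (v w : Idx m → k) : k := v ⬝ᵥ (gram S *ᵥ w)

/-- The isotropic vector `e = e₊ + e₋`. -/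
def eVec (k : Type*) [Field k] (m : ℕ) : Idx m → k :=
  Sum.elim (fun _ => 1) (Sum.elim (fun _ => 0) (fun _ => 1))

/-- The isotropic vector `e' = (e₊ - e₋) / 2`; it is orthogonal to `k^m` and `⟨e, e'⟩ = 1`. -/
def eDual (k : Type*) [Field k] (m : ℕ) : Idx m → k :=
  Sum.elim (fun _ => 2⁻¹) (Sum.elim (fun _ => 0) (fun _ => -2⁻¹))

/-- The orthogonal group `G = O(m+2)` of the form, as a group of matrices acting on row vectors
on the right: `⟨v g, w g⟩ = ⟨v, w⟩`. -/
def orthGroup (S : Matrix (Fin m) (Fin m) k) : Subgroup (GL (Idx m) k) where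
  carrier := {g | ∀ v w : Idx m → k, pairing S (v ᵥ* g.1) (w ᵥ* g.1) = pairing S v w}
  one_mem' := by intro v w; simp
  mul_mem' := by
    intro g h hg hh v w
    have e1 : ∀ u : Idx m → k, u ᵥ* (g * h).1 = (u ᵥ* g.1) ᵥ* h.1 := by
      intro u; simp [Matrix.vecMul_vecMul]
    rw [e1, e1, hh, hg]
  inv_mem' := by
    intro g hg v w
    have e1 : ∀ u : Idx m → k, (u ᵥ* (g⁻¹).1) ᵥ* g.1 = u := by
      intro u
      rw [Matrix.vecMul_vecMul, ← Units.val_mul, inv_mul_cancel, Units.val_one, Matrix.vecMul_one]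
    rw [← hg, e1, e1]

/-- The unipotent radical `N` of the parabolic subgroup `P` of `G` stabilizing the isotropic line
`k · e`: the elements of `G` that act trivially on the successive quotients of the flag
`k · e ⊆ e^⊥ ⊆ k^{m+2}` (triviality on the last quotient follows from isometry). -/
def unipotentRadical (S : Matrix (Fin m) (Fin m) k) : Subgroup (GL (Idx m) k) where
  carrier := {g | g ∈ orthGroup S ∧ eVec k m ᵥ* g.1 = eVec k m ∧
    ∀ v : Idx m → k, pairing S v (eVec k m) = 0 → ∃ c : k, v ᵥ* g.1 = v + c • eVec k m}
  one_mem' := by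
    refine ⟨one_mem _, by simp, fun v _ => ⟨0, by simp⟩⟩
  mul_mem' := by
    rintro g h ⟨hg, hge, hgv⟩ ⟨hh, hhe, hhv⟩
    have e1 : ∀ u : Idx m → k, u ᵥ* (g * h).1 = (u ᵥ* g.1) ᵥ* h.1 := by
      intro u; simp [Matrix.vecMul_vecMul]
    refine ⟨mul_mem hg hh, by rw [e1, hge, hhe], fun v hv => ?_⟩
    obtain ⟨c, hc⟩ := hgv v hv
    obtain ⟨d, hd⟩ := hhv v hv
    refine ⟨d + c, ?_⟩
    rw [e1, hc, Matrix.add_vecMul, Matrix.smul_vecMul, hhe, hd, add_smul, add_assoc]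
  inv_mem' := by
    rintro g ⟨hg, hge, hgv⟩
    have e1 : ∀ u : Idx m → k, (u ᵥ* g.1) ᵥ* (g⁻¹).1 = u := by
      intro u
      rw [Matrix.vecMul_vecMul, ← Units.val_mul, mul_inv_cancel, Units.val_one, Matrix.vecMul_one]
    have e2 : eVec k m ᵥ* (g⁻¹).1 = eVec k m := by
      have := e1 (eVec k m)
      rwa [hge] at this
    refine ⟨inv_mem hg, e2, fun v hv => ?_⟩
    obtain ⟨c, hc⟩ := hgv v hv
    refine ⟨-c, ?_⟩
    have h3 := e1 v
    rw [hc, Matrix.add_vecMul, Matrix.smul_vecMul, e2] at h3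
    rw [neg_smul, ← sub_eq_add_neg]
    exact eq_sub_of_add_eq h3

/-- `m` belongs to the Levi component `M` of `P` and `e · m = e / lam`: `m` is an isometry that
stabilizes the line `k · e` and the subspace `k^m = {e₊, e₋}^⊥`. -/
def IsLevi (S : Matrix (Fin m) (Fin m) k) (g : GL (Idx m) k) (lam : kˣ) : Prop :=
  g ∈ orthGroup S ∧ eVec k m ᵥ* g.1 = ((lam⁻¹ : kˣ) : k) • eVec k m ∧
    ∀ a : Fin m → k, ∃ b : Fin m → k,
      (Sum.elim (0 : Unit → k) (Sum.elim a (0 : Unit → k))) ᵥ* g.1 =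
        Sum.elim (0 : Unit → k) (Sum.elim b (0 : Unit → k))

/-- `ξ` represents the long Weyl element: an isometry exchanging `e` and `e'`. -/
def IsLongWeyl (S : Matrix (Fin m) (Fin m) k) (ξ : GL (Idx m) k) : Prop :=
  ξ ∈ orthGroup S ∧ eVec k m ᵥ* ξ.1 = eDual k m ∧ eDual k m ᵥ* ξ.1 = eVec k m

end Group

section Local

variable {k : Type*} [NontriviallyNormedField k] [IsUltrametricDist k] {m : ℕ}

/-- The characteristic function `Φ` of `𝒪^{m+2}`. -/
noncomputable def latticeChar (v : Idx m → k) : ℂ :=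
  Set.indicator {v : Idx m → k | ∀ i, v i ∈ 𝒪[k]} (fun _ => (1 : ℂ)) v

variable [MeasurableSpace k]

/-- `φ(g) = ∫_{kˣ} |t|^α Φ(t e · g) dt`, where `τ` is the measure on `kˣ`. -/
noncomputable def sphericalInt (τ : Measure kˣ) (α : ℂ) (g : GL (Idx m) k) : ℂ :=
  ∫ t : kˣ, ((‖(t : k)‖ : ℝ) : ℂ) ^ α * latticeChar ((t : k) • (eVec k m ᵥ* g.1)) ∂τ

/-- The normalized spherical function `φ°(g) = φ(g) / φ(1)`. -/
noncomputable def spherical (τ : Measure kˣ) (α : ℂ) (g : GL (Idx m) k) : ℂ :=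
  sphericalInt τ α g / sphericalInt τ α (1 : GL (Idx m) k)

/-- `X_ℓ(ρ) = meas {a ∈ 𝒪^m : B(a) = ρ mod ϖ^ℓ}`, where `ν` is the measure on `k`. -/
noncomputable def congrMeas (ν : Measure k) (S : Matrix (Fin m) (Fin m) k) (ρ : k) (l : ℕ) : ℝ :=
  (Measure.pi (fun _ : Fin m => ν)).real
    {a | (∀ i, a i ∈ 𝒪[k]) ∧ ∃ y : 𝒪[k], y ∈ 𝓂[k] ^ l ∧ quadForm S a - ρ = (y : k)}

/-- The `l`-th term `q^{-βl} X_l(ρ)` of the series `X(β; ρ)`. -/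
noncomputable def congrTerm (ν : Measure k) (S : Matrix (Fin m) (Fin m) k) (β : ℂ) (ρ : k)
    (l : ℕ) : ℂ :=
  ((residueCard k : ℂ) ^ (-β)) ^ l * (congrMeas ν S ρ l : ℂ)

/-- `X(β; ρ) = ∑_{l ≥ 0} q^{-βl} X_l(ρ)`. -/
noncomputable def congrSeries (ν : Measure k) (S : Matrix (Fin m) (Fin m) k) (β : ℂ) (ρ : k) : ℂ :=
  ∑' l : ℕ, congrTerm ν S β ρ l

/-- The local zeta factor `Z(α) = 1 / (1 - q^{-α})`. -/
noncomputable def localZeta (k : Type*) [NontriviallyNormedField k] [IsUltrametricDist k]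
    (α : ℂ) : ℂ :=
  1 / (1 - (residueCard k : ℂ) ^ (-α))

end Local

end OrthConst

namespace OrthConst

/-! Let a be the coordinate of u ∈ N. Since eξ = e', the vector e·ξum is the image of e' + a -
½B(a)e under m. A Levi element acts on k^{n+1} by an isometry A of B, on e by 1/λ and, as an
isometry, on e' by λ, so this image is λ times the vector of the same shape with coordinate b =
λ⁻¹aA (`eVec_vecMul_eq`). Because |2| = 1, its sup norm is |λ| r(b), where r(b) = max(1, |b|,
|B(b)|) (`forall_norm_mul_cuspVec_le_iff`). Translating t in φ and dividing by φ(1) = Z(α) gives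
φ°(ξum) = |λ|^{-α} r(b)^{-α}.

The coordinate carries dn to da (`map_midComp_unipotent`), and passing from a to b contributes
|λ|^{n+1} because |det A| = 1 (`measurePreserving_block`). What remains is ∫ r^{-α}. Writing r = q^R
and w = q^{-α}, summation by layers gives (1 - w) ∑ w^l meas{R ≤ l}, with 1 - w = 1/Z(α)
(`integral_pow_eq_tsum`). Dilation by ϖ^l turns {R ≤ l} into the set defining X_l(0), at the price
of q^{(n+1)l} (`measure_radius_le`). The same computation with absolute values decides convergence
(`integrable_pow_iff_summable`). -/

/-! ### The normalized absolute value, and Haar measure under linear maps. -/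

open Matrix in
lemma measurePreserving_transvectionStruct {k : Type*} [NontriviallyNormedField k]
    [ProperSpace k] [MeasurableSpace k] [BorelSpace k] (ν : Measure k) [ν.IsAddHaarMeasure]
    {ι : Type*} [Fintype ι] [DecidableEq ι] (t : TransvectionStruct ι k) :
    MeasurePreserving (toLin' t.toMatrix) (Measure.pi fun _ : ι => ν)
      (Measure.pi fun _ : ι => ν) := by
  have ht : Measurable (toLin' t.toMatrix) := (LinearMap.continuous_on_pi _).measurable
  refine ⟨ht, (Measure.pi_eq fun s hs ↦ ?_).symm⟩
  have h2s : MeasurableSet (Set.univ.pi s) := .univ_pi hs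
  rw [← Measure.pi_pi, ← lintegral_indicator_one h2s, ← lintegral_indicator_one h2s]
  rw [lintegral_map (measurable_one.indicator h2s) ht]
  -- Integrate coordinate `t.i` first: with the others frozen, the transvection is a translation in
  -- it.
  refine lintegral_eq_of_lmarginal_eq {t.i} ((measurable_one.indicator h2s).comp ht)
    (measurable_one.indicator h2s) ?_
  simp_rw [lmarginal_singleton]
  ext x
  cases t with | mk t_i t_j t_hij t_c =>
  simp [transvection, single_mulVec, t_hij.symm, ← Function.update_add,
    lintegral_add_right_eq_self fun xᵢ ↦ Set.indicator (Set.univ.pi s) 1 (Function.update x t_i xᵢ)]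

section LocalField

variable {k : Type*} [NontriviallyNormedField k] [IsUltrametricDist k] [ProperSpace k]

instance isDiscreteValuationRing_integer : IsDiscreteValuationRing 𝒪[k] := by
  have hc : CompactSpace 𝒪[k] := by
    rw [← isCompact_univ_iff, Subtype.isCompact_iff]
    have : (Subtype.val '' (Set.univ : Set 𝒪[k])) = Metric.closedBall (0 : k) 1 := by
      ext x; simp [Valued.integer.mem_iff]
    rw [this]
    exact isCompact_closedBall 0 1
  have : (Valued.v : Valuation k NNReal).IsNontrivial := by
    obtain ⟨x, hx, hx'⟩ := NormedField.exists_norm_lt_one k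
    refine ⟨⟨x, ?_, ?_⟩⟩
    · simpa [NormedField.v_eq_valuation] using hx
    · intro h
      have := congrArg NNReal.toReal h
      simp at this
      linarith
  exact Valued.integer.isDiscreteValuationRing_of_compactSpace

variable (hk : ∀ ϖ : 𝒪[k], Irreducible ϖ → ‖(ϖ : k)‖ = ((OrthConst.residueCard k : ℕ) : ℝ)⁻¹)
include hk

lemma exists_norm_eq_inv_residueCard : ∃ ϖ : kˣ, ‖(ϖ : k)‖ = (residueCard k : ℝ)⁻¹ := by
  obtain ⟨ϖ, h⟩ := IsDiscreteValuationRing.exists_irreducible 𝒪[k]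
  refine ⟨Units.mk0 (ϖ : k) ?_, hk ϖ h⟩
  have := h.ne_zero
  simpa using this

/-- As a `Nat.card`, q would be 0 for an infinite residue field. The normalization together with 0 <
|ϖ| < 1 excludes this, so finiteness of the residue field is contained here. -/
lemma one_lt_residueCard : 1 < residueCard k := by
  obtain ⟨ϖ, h⟩ := IsDiscreteValuationRing.exists_irreducible 𝒪[k]
  have h0 : 0 < ‖(ϖ : k)‖ := Valued.integer.norm_irreducible_pos h
  have h1 : ‖(ϖ : k)‖ < 1 := Valued.integer.norm_irreducible_lt_one h
  rw [hk ϖ h] at h0 h1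
  have h2 : (0 : ℝ) < residueCard k := inv_pos.1 h0
  have := (inv_lt_one₀ h2).1 h1
  exact_mod_cast this

lemma mem_maximalIdeal_pow_iff (l : ℕ) (y : 𝒪[k]) :
    y ∈ 𝓂[k] ^ l ↔ ‖(y : k)‖ ≤ ((residueCard k : ℝ) ^ l)⁻¹ := by
  obtain ⟨ϖ, h⟩ := IsDiscreteValuationRing.exists_irreducible 𝒪[k]
  have := Set.ext_iff.1 (h.maximalIdeal_pow_eq_closedBall_pow l) y
  have e : ‖ϖ‖ = (residueCard k : ℝ)⁻¹ := hk ϖ h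
  rw [e] at this
  simpa using this

lemma exists_norm_eq_zpow {x : k} (hx : x ≠ 0) : ∃ j : ℤ, ‖x‖ = (residueCard k : ℝ) ^ j := by
  obtain ⟨ϖ, h⟩ := IsDiscreteValuationRing.exists_irreducible 𝒪[k]
  have key : ∀ y : k, y ≠ 0 → ‖y‖ ≤ 1 → ∃ j : ℤ, ‖y‖ = (residueCard k : ℝ) ^ j := by
    intro y hy hy1
    obtain ⟨j, u, hu⟩ := IsDiscreteValuationRing.eq_unit_mul_pow_irreducible
      (x := (⟨y, Valued.integer.mem_iff.2 hy1⟩ : 𝒪[k])) (by simpa [Subtype.ext_iff] using hy) h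
    have := congrArg (fun z : 𝒪[k] => ‖(z : k)‖) hu
    simp only [Subring.coe_mul, Subring.coe_pow, norm_mul, norm_pow, hk ϖ h,
      Valued.integer.norm_coe_unit, one_mul] at this
    exact ⟨-j, by rw [this]; simp⟩
  rcases le_total ‖x‖ 1 with h1 | h1
  · exact key x hx h1
  · obtain ⟨j, hj⟩ := key x⁻¹ (inv_ne_zero hx) (by rw [norm_inv]; exact inv_le_one_of_one_le₀ h1)
    exact ⟨-j, by rw [zpow_neg, ← hj]; simp⟩

variable [MeasurableSpace k] [BorelSpace k] (ν : Measure k) [ν.IsAddHaarMeasure]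

/-- The unit ball is the disjoint union of q translates of the maximal ideal, one for each residue
class. -/
lemma measure_uniformizer_ball :
    (residueCard k : ENNReal) * ν {x : k | ‖x‖ ≤ (residueCard k : ℝ)⁻¹} = ν {x : k | ‖x‖ ≤ 1} := by
  have hfin : Finite 𝓀[k] := Nat.finite_of_card_ne_zero (by
    have := one_lt_residueCard hk
    unfold residueCard at this
    omega)
  have hm : MeasurableSet {x : k | ‖x‖ ≤ (residueCard k : ℝ)⁻¹} :=
    measurableSet_le measurable_norm measurable_const
  have hmem : ∀ x y : 𝒪[k], IsLocalRing.residue 𝒪[k] x = IsLocalRing.residue 𝒪[k] y ↔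
      ‖(x : k) - y‖ ≤ (residueCard k : ℝ)⁻¹ := by
    intro x y
    rw [← sub_eq_zero, ← map_sub, IsLocalRing.residue_eq_zero_iff]
    simpa using mem_maximalIdeal_pow_iff hk 1 (x - y)
  choose r hr using IsLocalRing.residue_surjective (R := 𝒪[k])
  have hU : {x : k | ‖x‖ ≤ 1} =
      ⋃ c : 𝓀[k], (fun x => -(r c : k) + x) ⁻¹' {x : k | ‖x‖ ≤ (residueCard k : ℝ)⁻¹} := by
    ext x
    simp only [Set.mem_ofPred_eq, Set.mem_iUnion, Set.mem_preimage]
    constructor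
    · intro hx
      refine ⟨IsLocalRing.residue 𝒪[k] ⟨x, Valued.integer.mem_iff.2 hx⟩, ?_⟩
      rw [neg_add_eq_sub]
      exact (hmem ⟨x, Valued.integer.mem_iff.2 hx⟩ _).1 (hr _).symm
    · rintro ⟨c, hc⟩
      have h1 : ‖(r c : k)‖ ≤ 1 := Valued.integer.mem_iff.1 (r c).2
      have h2 : (residueCard k : ℝ)⁻¹ ≤ 1 :=
        inv_le_one_of_one_le₀ (by exact_mod_cast (one_lt_residueCard hk).le)
      calc ‖x‖ = ‖(r c : k) + (-(r c : k) + x)‖ := by rw [add_neg_cancel_left]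
        _ ≤ max ‖(r c : k)‖ ‖-(r c : k) + x‖ := IsUltrametricDist.norm_add_le_max _ _
        _ ≤ 1 := max_le h1 (hc.trans h2)
  rw [hU, measure_iUnion]
  · simp only [measure_preimage_add, ENNReal.tsum_const, ENat.card_eq_coe_natCard]
    rfl
  · intro c d hcd
    refine Set.disjoint_left.2 fun x hx hy => hcd ?_
    simp only [Set.mem_preimage, Set.mem_ofPred_eq] at hx hy
    rw [← hr c, ← hr d, hmem]
    calc ‖(r c : k) - r d‖ = ‖(-(r d : k) + x) - (-(r c : k) + x)‖ := by congr 1; ring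
      _ ≤ max ‖-(r d : k) + x‖ ‖-(r c : k) + x‖ := by
          rw [sub_eq_add_neg, ← norm_neg (-(r c : k) + x)]
          exact IsUltrametricDist.norm_add_le_max _ _
      _ ≤ _ := max_le hy hx
  · exact fun c => measurable_const_add _ hm

-- The modulus `distribHaarChar` is a homomorphism on kˣ. It is 1 on units, which preserve the unit
-- ball, and |ϖ| at ϖ by `measure_uniformizer_ball`; units and ϖ generate kˣ.
open scoped Pointwise in
lemma measure_preimage_mul_left (c : kˣ) (s : Set k) :
    ν ((fun x => (c : k) * x) ⁻¹' s) = ENNReal.ofReal ‖(c : k)‖⁻¹ * ν s := by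
  have h0 : ν {x : k | ‖x‖ ≤ 1} ≠ 0 := by
    have : {x : k | ‖x‖ ≤ 1} = Metric.closedBall 0 1 := by ext; simp
    rw [this]
    exact (Metric.measure_closedBall_pos ν 0 one_pos).ne'
  have h1 : ν {x : k | ‖x‖ ≤ 1} ≠ ⊤ := by
    have : {x : k | ‖x‖ ≤ 1} = Metric.closedBall 0 1 := by ext; simp
    rw [this]
    exact (isCompact_closedBall _ _).measure_ne_top
  have hq := one_lt_residueCard hk
  have hsmul : ∀ c : kˣ, c • {x : k | ‖x‖ ≤ 1} = {x : k | ‖x‖ ≤ ‖(c : k)‖} := by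
    intro c
    ext x
    rw [Set.mem_smul_set_iff_inv_smul_mem]
    simp [Units.smul_def, inv_mul_le_iff₀]
  obtain ⟨ϖ, hϖ⟩ := exists_norm_eq_inv_residueCard hk
  have hone : ∀ u : kˣ, ‖(u : k)‖ = 1 → distribHaarChar k u = 1 := by
    intro u hu
    refine distribHaarChar_eq_of_measure_smul_eq_mul h0 h1 ?_
    rw [hsmul, hu]; simp
  have hpi : distribHaarChar k ϖ = ‖(ϖ : k)‖₊ := by
    refine distribHaarChar_eq_of_measure_smul_eq_mul h0 h1 ?_
    rw [hsmul, hϖ, ← measure_uniformizer_ball hk ν, ← mul_assoc]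
    have : (‖(ϖ : k)‖₊ : ENNReal) = (residueCard k : ENNReal)⁻¹ := by
      have : ‖(ϖ : k)‖₊ = (residueCard k : NNReal)⁻¹ := by
        ext; simpa using hϖ
      rw [this, ENNReal.coe_inv (by simp; omega)]
      simp
    rw [this, ENNReal.inv_mul_cancel (by simp; omega) (by simp), one_mul]
  have hall : ∀ c : kˣ, distribHaarChar k c = ‖(c : k)‖₊ := by
    intro c
    obtain ⟨j, hj⟩ := exists_norm_eq_zpow hk c.ne_zero
    have hu : ‖((c * ϖ ^ j : kˣ) : k)‖ = 1 := by
      have : (residueCard k : ℝ) ≠ 0 := by positivity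
      simp [hj, hϖ, mul_inv_cancel₀ (zpow_ne_zero j this)]
    have e := hone _ hu
    rw [map_mul, map_zpow, hpi] at e
    have e2 : ‖(c : k)‖₊ * ‖(ϖ : k)‖₊ ^ j = 1 := by
      ext; simpa using hu
    have h3 : ‖(ϖ : k)‖₊ ^ j ≠ 0 := by simp [zpow_ne_zero]
    exact mul_right_cancel₀ h3 (e.trans e2.symm)
  have : (fun x => (c : k) * x) ⁻¹' s = c⁻¹ • s := by
    ext x
    rw [Set.mem_smul_set_iff_inv_smul_mem]
    simp [Units.smul_def]
  rw [this, ← distribHaarChar_mul ν, hall, ← norm_inv, ← Units.val_inv_eq_inv_val,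
    ← enorm_eq_nnnorm, ofReal_norm]

variable {ι : Type*} [Fintype ι] [DecidableEq ι]

open Matrix in
lemma map_diagonal_pi {D : ι → k} (h : (diagonal D).det ≠ 0) :
    Measure.map (toLin' (diagonal D)) (Measure.pi fun _ : ι => ν) =
      ENNReal.ofReal ‖(diagonal D).det‖⁻¹ • Measure.pi fun _ : ι => ν := by
  have hD : ∀ i, D i ≠ 0 := by
    intro i
    rw [det_diagonal] at h
    exact Finset.prod_ne_zero_iff.1 h i (Finset.mem_univ i)
  have hmeas : Measurable (toLin' (diagonal D)) :=
    (LinearMap.continuous_on_pi _).measurable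
  -- Solved for the product measure, because `Measure.pi_eq` recognizes that measure by its values
  -- on boxes.
  have key : Measure.pi (fun _ : ι => ν) = ENNReal.ofReal ‖(diagonal D).det‖ •
      Measure.map (toLin' (diagonal D)) (Measure.pi fun _ : ι => ν) := by
    refine Measure.pi_eq fun s hs => ?_
    rw [Measure.smul_apply, Measure.map_apply hmeas (MeasurableSet.univ_pi hs)]
    have : toLin' (diagonal D) ⁻¹' Set.univ.pi s = Set.univ.pi fun i => (D i * ·) ⁻¹' s i := by
      ext f
      simp [diagonal_toLin']
    have e : ∀ i, ν ((D i * ·) ⁻¹' s i) = ENNReal.ofReal ‖D i‖⁻¹ * ν (s i) := fun i =>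
      measure_preimage_mul_left hk ν (Units.mk0 (D i) (hD i)) (s i)
    rw [this, Measure.pi_pi, det_diagonal, norm_prod,
      ENNReal.ofReal_prod_of_nonneg fun i _ => norm_nonneg _, smul_eq_mul,
      ← Finset.prod_mul_distrib]
    refine Finset.prod_congr rfl fun i _ => ?_
    rw [e, ← mul_assoc, ← ENNReal.ofReal_mul (norm_nonneg _),
      mul_inv_cancel₀ (norm_ne_zero_iff.2 (hD i)), ENNReal.ofReal_one, one_mul]
  conv_rhs => rw [key]
  rw [smul_smul, ← ENNReal.ofReal_mul (by positivity), inv_mul_cancel₀ (norm_ne_zero_iff.2 h),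
    ENNReal.ofReal_one, one_smul]

-- Invertible matrices are products of transvections and diagonal matrices, and the formula is
-- multiplicative.
open Matrix in
lemma map_matrix_pi {M : Matrix ι ι k} (hM : M.det ≠ 0) :
    Measure.map (toLin' M) (Measure.pi fun _ : ι => ν) =
      ENNReal.ofReal ‖M.det‖⁻¹ • Measure.pi fun _ : ι => ν := by
  apply diagonal_transvection_induction_of_det_ne_zero _ M hM
  · exact fun D hD => map_diagonal_pi hk ν hD
  · intro t
    simp [(measurePreserving_transvectionStruct ν t).map_eq]
  · intro A B _ _ IHA IHB
    have hc : ∀ A : Matrix ι ι k, Measurable (toLin' A) := fun A =>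
      (LinearMap.continuous_on_pi _).measurable
    rw [toLin'_mul, det_mul, LinearMap.coe_comp, ← Measure.map_map (hc A) (hc B), IHB,
      Measure.map_smul, IHA, smul_smul, ← ENNReal.ofReal_mul (by positivity), norm_mul, mul_comm,
      mul_inv]

end LocalField

lemma ofReal_zpow_cpow {x : ℝ} (hx : 0 < x) (j : ℤ) (α : ℂ) :
    ((x ^ j : ℝ) : ℂ) ^ α = ((x : ℂ) ^ α) ^ j := by
  have h1 : ((x ^ j : ℝ) : ℂ) ≠ 0 := by exact_mod_cast (zpow_pos hx j).ne'
  have h2 : (x : ℂ) ≠ 0 := by exact_mod_cast hx.ne'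
  rw [Complex.cpow_def_of_ne_zero h1, Complex.cpow_def_of_ne_zero h2, ← Complex.exp_int_mul,
    ← Complex.ofReal_log (zpow_pos hx j).le, ← Complex.ofReal_log hx.le, Real.log_zpow]
  push_cast
  ring_nf

lemma norm_natCast_cpow_neg_lt_one {q : ℕ} (hq : 1 < q) {α : ℂ} (hα : 0 < α.re) :
    ‖(q : ℂ) ^ (-α)‖ < 1 := by
  rw [Complex.norm_natCast_cpow_of_pos (by omega), Complex.neg_re]
  exact Real.rpow_lt_one_of_one_lt_of_neg (by exact_mod_cast hq) (by linarith)

/-! ### Integrals of w^R by summation over sublevel sets. -/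

section LayerCake

variable {X : Type*} [MeasurableSpace X] (ρ : Measure X) {R : X → ℕ} {w : ℂ}

/-- Pointwise, |w|^{R(x)} = (1 - |w|) ∑_{l ≥ R(x)} |w|^l. By Tonelli no finiteness is needed, so the
identity can decide integrability. -/
lemma lintegral_enorm_pow (hR : Measurable R) (hw : ‖w‖ < 1) :
    ∫⁻ x, ‖w ^ R x‖ₑ ∂ρ = (1 - ‖w‖ₑ) * ∑' l : ℕ, ‖w‖ₑ ^ l * ρ {x | R x ≤ l} := by
  have hr : ‖w‖ₑ < 1 := by
    rw [← ofReal_norm, ← ENNReal.ofReal_one]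
    exact (ENNReal.ofReal_lt_ofReal_iff one_pos).2 hw
  have hA : ∀ l, MeasurableSet {x | R x ≤ l} := fun l => measurableSet_le hR measurable_const
  have hpt : ∀ x, ‖w ^ R x‖ₑ =
      (1 - ‖w‖ₑ) * ∑' l : ℕ, Set.indicator {x | R x ≤ l} (fun _ => ‖w‖ₑ ^ l) x := by
    intro x
    have hs : ∑' l : ℕ, Set.indicator {x | R x ≤ l} (fun _ => ‖w‖ₑ ^ l) x =
        ‖w‖ₑ ^ R x * (1 - ‖w‖ₑ)⁻¹ := by
      rw [← ENNReal.summable.sum_add_tsum_nat_add' (k := R x), Finset.sum_eq_zero, zero_add,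
        ← ENNReal.tsum_geometric, ← ENNReal.tsum_mul_left]
      · refine tsum_congr fun l => ?_
        rw [Set.indicator_of_mem (by simp), add_comm, pow_add]
      · intro l hl
        exact Set.indicator_of_notMem (by simpa using hl) _
    rw [hs, mul_left_comm, ENNReal.mul_inv_cancel (tsub_pos_of_lt hr).ne' (by simp), mul_one,
      enorm_pow]
  simp_rw [hpt]
  rw [lintegral_const_mul, lintegral_tsum]
  · simp_rw [lintegral_indicator_const (hA _)]
  · exact fun l => (measurable_const.indicator (hA l)).aemeasurable
  · exact Measurable.tsum fun l => measurable_const.indicator (hA l)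

lemma integrable_pow_iff_summable (hR : Measurable R) (hw : ‖w‖ < 1)
    (hfin : ∀ l : ℕ, ρ {x | R x ≤ l} ≠ ⊤) :
    Integrable (fun x => w ^ R x) ρ ↔ Summable fun l : ℕ => w ^ l * (ρ.real {x | R x ≤ l} : ℂ) := by
  have hm : AEStronglyMeasurable (fun x => w ^ R x) ρ :=
    ((measurable_from_nat (f := fun j => w ^ j)).comp hR).aestronglyMeasurable
  have hr : ‖w‖ₑ < 1 := by
    rw [← ofReal_norm, ← ENNReal.ofReal_one]
    exact (ENNReal.ofReal_lt_ofReal_iff one_pos).2 hw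
  have hterm : ∀ l : ℕ, ‖w‖ₑ ^ l * ρ {x | R x ≤ l} =
      ((‖w ^ l * (ρ.real {x | R x ≤ l} : ℂ)‖₊ : NNReal) : ENNReal) := by
    intro l
    rw [← enorm_eq_nnnorm, enorm_mul, enorm_pow]
    congr 1
    rw [← ofReal_norm, Complex.norm_real, Real.norm_of_nonneg measureReal_nonneg,
      ofReal_measureReal (hfin l)]
  rw [Integrable, and_iff_right hm, HasFiniteIntegral, lintegral_enorm_pow ρ hR hw,
    ENNReal.mul_lt_top_iff]
  simp_rw [hterm]
  rw [← summable_norm_iff]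
  -- The prefactor is neither 0 nor ∞, hence irrelevant for finiteness.
  have h1 : (1 - ‖w‖ₑ) ≠ 0 := (tsub_pos_of_lt hr).ne'
  have h2 : (1 - ‖w‖ₑ) < ⊤ := tsub_le_self.trans_lt ENNReal.one_lt_top
  have h3 : (Summable fun l : ℕ => ‖w ^ l * (ρ.real {x | R x ≤ l} : ℂ)‖) ↔
      Summable fun l : ℕ => ‖w ^ l * (ρ.real {x | R x ≤ l} : ℂ)‖₊ := by
    rw [← NNReal.summable_coe]; rfl
  rw [h3, ← ENNReal.tsum_coe_ne_top_iff_summable, ← lt_top_iff_ne_top]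
  constructor
  · rintro (h | h | h)
    · exact h.2
    · exact absurd h h1
    · rw [h]; exact ENNReal.zero_lt_top
  · exact fun h => Or.inl ⟨h2, h⟩

lemma integral_pow_eq_tsum (hR : Measurable R) (hw : ‖w‖ < 1)
    (hfin : ∀ l : ℕ, ρ {x | R x ≤ l} ≠ ⊤)
    (hs : Summable fun l : ℕ => w ^ l * (ρ.real {x | R x ≤ l} : ℂ)) :
    ∫ x, w ^ R x ∂ρ = (1 - w) * ∑' l : ℕ, w ^ l * (ρ.real {x | R x ≤ l} : ℂ) := by
  have hA : ∀ l, MeasurableSet {x | R x ≤ l} := fun l => measurableSet_le hR measurable_const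
  have hpt : ∀ x, w ^ R x =
      (1 - w) * ∑' l : ℕ, Set.indicator {x | R x ≤ l} (fun _ => w ^ l) x := by
    intro x
    have hs : ∑' l : ℕ, Set.indicator {x | R x ≤ l} (fun _ => w ^ l) x =
        w ^ R x * (1 - w)⁻¹ := by
      have hsm : Summable fun l : ℕ => Set.indicator {x | R x ≤ l} (fun _ => w ^ l) x :=
        (summable_geometric_of_lt_one (norm_nonneg w) hw).of_norm_bounded fun l => by
          rw [← norm_pow]; exact norm_indicator_le_norm_self (fun _ => w ^ l) x
      rw [← hsm.sum_add_tsum_nat_add (R x), Finset.sum_eq_zero, zero_add,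
        ← tsum_geometric_of_norm_lt_one hw, ← tsum_mul_left]
      · refine tsum_congr fun l => ?_
        rw [Set.indicator_of_mem (by simp), add_comm, pow_add]
      · intro l hl
        exact Set.indicator_of_notMem (by simpa using hl) _
    have h1 : 1 - w ≠ 0 := sub_ne_zero.2 fun h => by rw [← h] at hw; simp at hw
    rw [hs]; field_simp
  have hint : ∀ l : ℕ, ∀ c : ℂ, ∫ x, Set.indicator {x | R x ≤ l} (fun _ => c) x ∂ρ =
      c * (ρ.real {x | R x ≤ l} : ℂ) := by
    intro l c
    rw [integral_indicator_const _ (hA l), Complex.real_smul, mul_comm]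
  simp_rw [hpt]
  rw [integral_const_mul]
  congr 1
  rw [← integral_tsum_of_summable_integral_norm]
  · exact tsum_congr fun l => hint l _
  · exact fun l => (integrable_indicator_iff (hA l)).2 (integrableOn_const (hfin l))
  · refine hs.norm.congr fun l => ?_
    simp_rw [norm_indicator_eq_indicator_norm]
    rw [integral_indicator_const _ (hA l), norm_mul, Complex.norm_real,
      Real.norm_of_nonneg measureReal_nonneg, smul_eq_mul, mul_comm]

end LayerCake

/-! ### The local zeta integral over kˣ. -/

section Zeta

variable {k : Type*} [NontriviallyNormedField k] [IsUltrametricDist k] [ProperSpace k]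
  [MeasurableSpace k] [BorelSpace k]

omit [IsUltrametricDist k] [ProperSpace k] in
instance borelSpace_units : BorelSpace kˣ :=
  ⟨by
    rw [Units.isEmbedding_val₀.eq_induced, borel_comap, ← BorelSpace.measurable_eq]
    rfl⟩

/-- The punctured unit ball splits into the shells |t| = q^{-j}, all translates of 𝒪ˣ and so of
volume 1; the integral is a geometric series. -/
lemma integral_ball_norm_cpow
    (hk : ∀ ϖ : 𝒪[k], Irreducible ϖ → ‖(ϖ : k)‖ = ((OrthConst.residueCard k : ℕ) : ℝ)⁻¹)
    (τ : Measure kˣ) [τ.IsHaarMeasure] (hτ : τ {t | ‖(t : k)‖ = 1} = 1)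
    {α : ℂ} (hα : 0 < α.re) :
    ∫ t : kˣ, Set.indicator {t : kˣ | ‖(t : k)‖ ≤ 1} (fun t => ((‖(t : k)‖ : ℝ) : ℂ) ^ α) t ∂τ =
      localZeta k α := by
  have hq := one_lt_residueCard hk
  have hq0 : (0 : ℝ) < residueCard k := by exact_mod_cast (by omega : 0 < residueCard k)
  set w : ℂ := (residueCard k : ℂ) ^ (-α) with hw
  have hw1 : ‖w‖ < 1 := norm_natCast_cpow_neg_lt_one hq hα
  have hnm : Measurable fun t : kˣ => ‖(t : k)‖ :=
    (continuous_norm.comp Units.continuous_val).measurable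
  let A : ℕ → Set kˣ := fun j => {t | ‖(t : k)‖ = (residueCard k : ℝ) ^ (-(j : ℤ))}
  have hA : ∀ j, MeasurableSet (A j) := fun j => measurableSet_eq_fun hnm measurable_const
  obtain ⟨ϖ, hϖ⟩ := exists_norm_eq_inv_residueCard hk
  have hτA : ∀ j, τ (A j) = 1 := by
    intro j
    rw [← hτ, ← measure_preimage_mul τ (ϖ ^ (-(j : ℤ))) {t | ‖(t : k)‖ = 1}]
    have hn : ‖((ϖ ^ (-(j : ℤ)) : kˣ) : k)‖ = (residueCard k : ℝ) ^ (j : ℤ) := by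
      rw [Units.val_zpow_eq_zpow_val, norm_zpow, hϖ, inv_zpow, zpow_neg, inv_inv]
    congr 1
    ext t
    simp only [A, Set.mem_ofPred_eq, Set.mem_preimage, Units.val_mul, norm_mul, hn]
    rw [zpow_neg, mul_comm, mul_eq_one_iff_eq_inv₀ (zpow_ne_zero _ hq0.ne')]
  have hval : ∀ j : ℕ, (((residueCard k : ℝ) ^ (-(j : ℤ)) : ℝ) : ℂ) ^ α = w ^ j := by
    intro j
    rw [ofReal_zpow_cpow hq0, hw, Complex.cpow_neg, zpow_neg, inv_pow, zpow_natCast]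
    simp
  have hinj : ∀ i j : ℕ, (residueCard k : ℝ) ^ (-(i : ℤ)) = (residueCard k : ℝ) ^ (-(j : ℤ)) →
      i = j := by
    intro i j h
    have := zpow_right_injective₀ hq0 (by exact_mod_cast hq.ne') h
    simpa using this
  have hpt : ∀ t : kˣ, Set.indicator {t : kˣ | ‖(t : k)‖ ≤ 1}
      (fun t => ((‖(t : k)‖ : ℝ) : ℂ) ^ α) t = ∑' j, Set.indicator (A j) (fun _ => w ^ j) t := by
    intro t
    obtain ⟨i, hi⟩ := exists_norm_eq_zpow hk t.ne_zero
    by_cases h : ‖(t : k)‖ ≤ 1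
    · have hi0 : i ≤ 0 := by
        by_contra hc
        have := one_lt_zpow₀ (by exact_mod_cast hq : (1 : ℝ) < residueCard k) (not_le.1 hc)
        linarith
      obtain ⟨j, rfl⟩ : ∃ j : ℕ, i = -(j : ℤ) := ⟨i.natAbs, by omega⟩
      rw [Set.indicator_of_mem (by exact h), tsum_eq_single j, Set.indicator_of_mem (by exact hi),
        hi, hval]
      intro j' hj'
      exact Set.indicator_of_notMem (fun h' => hj' (hinj _ _ (Eq.trans h'.symm hi))) _
    · rw [Set.indicator_of_notMem (by exact h)]
      have hz : ∀ j, Set.indicator (A j) (fun _ => w ^ j) t = 0 := fun j =>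
        Set.indicator_of_notMem (s := A j) (fun hj => h (by
          rw [show ‖(t : k)‖ = (residueCard k : ℝ) ^ (-(j : ℤ)) from hj, zpow_neg]
          exact inv_le_one_of_one_le₀ (one_le_zpow₀ (by exact_mod_cast hq.le) (by positivity)))) _
      simp_rw [hz, tsum_zero]
  simp_rw [hpt]
  have hreal : ∀ j, τ.real (A j) = 1 := fun j => by rw [measureReal_def, hτA]; rfl
  rw [← integral_tsum_of_summable_integral_norm]
  · simp_rw [integral_indicator_const _ (hA _), hreal, one_smul]
    rw [tsum_geometric_of_norm_lt_one hw1, localZeta, one_div]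
  · exact fun j => (integrable_indicator_iff (hA j)).2 (integrableOn_const (by rw [hτA]; simp))
  · simp_rw [norm_indicator_eq_indicator_norm, integral_indicator_const _ (hA _), hreal, one_smul,
      norm_pow]
    exact summable_geometric_of_lt_one (norm_nonneg _) hw1

/-- The scalar c stands for the sup norm of e·g, the only thing the integrand sees. Replacing t by
c⁻¹t leaves the zeta integral and the factor |c|^{-α}. -/
lemma sphericalInt_eq
    (hk : ∀ ϖ : 𝒪[k], Irreducible ϖ → ‖(ϖ : k)‖ = ((OrthConst.residueCard k : ℕ) : ℝ)⁻¹)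
    (τ : Measure kˣ) [τ.IsHaarMeasure] (hτ : τ {t | ‖(t : k)‖ = 1} = 1)
    {α : ℂ} (hα : 0 < α.re) {m : ℕ} (g : GL (Idx m) k) (c : kˣ)
    (hc : ∀ t : kˣ, (∀ i, ‖(t : k) * (eVec k m ᵥ* g.1) i‖ ≤ 1) ↔ ‖(t : k) * c‖ ≤ 1) :
    sphericalInt τ α g = ((‖(c : k)‖ : ℝ) : ℂ) ^ (-α) * localZeta k α := by
  rw [← integral_ball_norm_cpow hk τ hτ hα, ← integral_mul_left_eq_self _ c,
    ← integral_const_mul, sphericalInt]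
  refine integral_congr_ae (Filter.Eventually.of_forall fun t => ?_)
  have hc0 : ((‖(c : k)‖ : ℝ) : ℂ) ≠ 0 := by simp
  have hmul : ((‖((c * t : kˣ) : k)‖ : ℝ) : ℂ) ^ α =
      ((‖(c : k)‖ : ℝ) : ℂ) ^ α * ((‖(t : k)‖ : ℝ) : ℂ) ^ α := by
    rw [Units.val_mul, norm_mul, Complex.ofReal_mul,
      Complex.mul_cpow_ofReal_nonneg (norm_nonneg _) (norm_nonneg _)]
  have hiff : (∀ i, ((t : k) • (eVec k m ᵥ* g.1)) i ∈ 𝒪[k]) ↔ ‖((c * t : kˣ) : k)‖ ≤ 1 := by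
    rw [Units.val_mul, mul_comm, ← hc t]
    simp only [Pi.smul_apply, smul_eq_mul, Valued.integer.mem_iff]
  by_cases h : ‖((c * t : kˣ) : k)‖ ≤ 1
  · have h1 : latticeChar ((t : k) • (eVec k m ᵥ* g.1)) = 1 :=
      Set.indicator_of_mem (s := {v : Idx m → k | ∀ i, v i ∈ 𝒪[k]}) (hiff.2 h) _
    simp only [h1]
    rw [Set.indicator_of_mem (by exact h), hmul, Complex.cpow_neg, ← mul_assoc,
      inv_mul_cancel₀ (by simp [Complex.cpow_eq_zero_iff]), one_mul, mul_one]
  · have h1 : latticeChar ((t : k) • (eVec k m ᵥ* g.1)) = 0 :=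
      Set.indicator_of_notMem (s := {v : Idx m → k | ∀ i, v i ∈ 𝒪[k]})
        (fun h' => h (hiff.1 h')) _
    simp only [h1]
    rw [Set.indicator_of_notMem (by exact h), mul_zero, mul_zero]

end Zeta

/-! ### The quadratic space, its unipotent radical and its Levi elements. -/

section Algebra

variable {k : Type*} [Field k] {m : ℕ} {S : Matrix (Fin m) (Fin m) k}

/-- The embedding of `k^m` into `k^{m+2}`. -/
def midEmb (a : Fin m → k) : Idx m → k :=
  Sum.elim (0 : Unit → k) (Sum.elim a (0 : Unit → k))

/-- The `k^m`-component of a vector of `k^{m+2}`. -/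
def midComp (v : Idx m → k) : Fin m → k := fun i => v (Sum.inr (Sum.inl i))

lemma pairing_eq (v w : Idx m → k) : pairing S v w =
    v (Sum.inl ()) * w (Sum.inl ()) + midComp v ⬝ᵥ (S *ᵥ midComp w) -
      v (Sum.inr (Sum.inr ())) * w (Sum.inr (Sum.inr ())) := by
  have hw : w = Sum.elim (w ∘ Sum.inl) (w ∘ Sum.inr) := (Sum.elim_comp_inl_inr w).symm
  have hw' : w ∘ Sum.inr = Sum.elim (midComp w) (w ∘ Sum.inr ∘ Sum.inr) :=
    (Sum.elim_comp_inl_inr _).symm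
  have hg : gram S *ᵥ w = Sum.elim (w ∘ Sum.inl)
      (Sum.elim (S *ᵥ midComp w) (-(w ∘ Sum.inr ∘ Sum.inr))) := by
    conv_lhs => rw [hw, gram, Matrix.fromBlocks_mulVec, hw']
    simp only [Sum.elim_comp_inl, Sum.elim_comp_inr, Matrix.fromBlocks_mulVec]
    simp [Matrix.neg_mulVec]
  rw [pairing, hg]
  simp [dotProduct, Fintype.sum_sum_type, midComp]
  ring

omit [Field k] in
lemma idx_ext {v w : Idx m → k} (h1 : v (Sum.inl ()) = w (Sum.inl ()))
    (h2 : midComp v = midComp w) (h3 : v (Sum.inr (Sum.inr ())) = w (Sum.inr (Sum.inr ()))) :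
    v = w := by
  funext i
  rcases i with ⟨⟩ | i | ⟨⟩
  · exact h1
  · exact congrFun h2 i
  · exact h3

@[simp] lemma midComp_add (v w : Idx m → k) : midComp (v + w) = midComp v + midComp w := rfl
@[simp] lemma midComp_smul (c : k) (v : Idx m → k) : midComp (c • v) = c • midComp v := rfl
@[simp] lemma midComp_neg (v : Idx m → k) : midComp (-v) = -midComp v := rfl
@[simp] lemma midComp_midEmb (a : Fin m → k) : midComp (midEmb a) = a := rfl
@[simp] lemma midComp_eVec : midComp (eVec k m) = 0 := rfl
@[simp] lemma midComp_eDual : midComp (eDual k m) = 0 := rfl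
@[simp] lemma midEmb_inl (a : Fin m → k) : midEmb a (Sum.inl ()) = 0 := rfl
@[simp] lemma midEmb_inr (a : Fin m → k) : midEmb a (Sum.inr (Sum.inr ())) = 0 := rfl
@[simp] lemma eVec_inl : eVec k m (Sum.inl ()) = 1 := rfl
@[simp] lemma eVec_inr : eVec k m (Sum.inr (Sum.inr ())) = 1 := rfl
@[simp] lemma eDual_inl : eDual k m (Sum.inl ()) = 2⁻¹ := rfl
@[simp] lemma eDual_inr : eDual k m (Sum.inr (Sum.inr ())) = -2⁻¹ := rfl

lemma midEmb_add (a b : Fin m → k) : midEmb (a + b) = midEmb a + midEmb b := by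
  apply idx_ext <;> simp

lemma midEmb_smul (c : k) (a : Fin m → k) : midEmb (c • a) = c • midEmb a := by
  apply idx_ext <;> simp

lemma pairing_midEmb (a b : Fin m → k) : pairing S (midEmb a) (midEmb b) = a ⬝ᵥ (S *ᵥ b) := by
  simp [pairing_eq]

lemma pairing_add_left (u v w : Idx m → k) :
    pairing S (u + v) w = pairing S u w + pairing S v w := add_dotProduct _ _ _
lemma pairing_smul_left (c : k) (v w : Idx m → k) :
    pairing S (c • v) w = c * pairing S v w := smul_dotProduct _ _ _
lemma pairing_add_right (u v w : Idx m → k) :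
    pairing S u (v + w) = pairing S u v + pairing S u w := by
  simp [pairing, Matrix.mulVec_add]
lemma pairing_smul_right (c : k) (v w : Idx m → k) :
    pairing S v (c • w) = c * pairing S v w := by
  simp [pairing, Matrix.mulVec_smul]

lemma pairing_comm (hS : S.IsSymm) (v w : Idx m → k) : pairing S v w = pairing S w v := by
  have h : midComp v ⬝ᵥ (S *ᵥ midComp w) = midComp w ⬝ᵥ (S *ᵥ midComp v) := by
    rw [Matrix.dotProduct_mulVec, ← Matrix.mulVec_transpose, hS.eq, dotProduct_comm]
  rw [pairing_eq, pairing_eq, h]; ring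

/-- The image of `e'` under the unipotent element with `k^m`-component `a`. -/
def cuspVec (S : Matrix (Fin m) (Fin m) k) (a : Fin m → k) : Idx m → k :=
  eDual k m + midEmb a + (-(2⁻¹ * quadForm S a)) • eVec k m

variable (h2 : (2 : k) ≠ 0)
include h2

/-- With outer coordinates x, y and middle part a, the hypotheses read x - y = 1 and x² - y² =
-B(a); hence x + y = -B(a), and both are determined. -/
lemma eq_cuspVec {v : Idx m → k} (h : pairing S v v = 0) (he : pairing S v (eVec k m) = 1) :
    v = cuspVec S (midComp v) := by
  have hq : midComp v ⬝ᵥ (S *ᵥ midComp v) = quadForm S (midComp v) := rfl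
  rw [pairing_eq, hq] at h
  rw [pairing_eq] at he
  simp at he
  have e1 : v (Sum.inl ()) = 1 + v (Sum.inr (Sum.inr ())) := by linear_combination he
  rw [e1] at h
  have e2 : 2 * v (Sum.inr (Sum.inr ())) = -1 - quadForm S (midComp v) := by linear_combination h
  have e3 : v (Sum.inr (Sum.inr ())) = 2⁻¹ * (-1 - quadForm S (midComp v)) := by
    rw [← e2, inv_mul_cancel_left₀ h2]
  apply idx_ext
  · simp [cuspVec, e1, e3]; field_simp; ring
  · simp [cuspVec]
  · simp [cuspVec, e3]; ring

omit h2 in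
lemma pairing_eDual_eDual : pairing S (eDual k m) (eDual k m) = 0 := by
  simp [pairing_eq]

lemma pairing_eDual_eVec : pairing S (eDual k m) (eVec k m) = 1 := by
  simp [pairing_eq]; field_simp; norm_num

lemma eDual_vecMul_unipotent (u : unipotentRadical S) :
    eDual k m ᵥ* u.1.1 = cuspVec S (midComp (eDual k m ᵥ* u.1.1)) := by
  obtain ⟨u, hu, hue, -⟩ := u
  refine eq_cuspVec h2 ?_ ?_
  · rw [hu, pairing_eDual_eDual]
  · have := hu (eDual k m) (eVec k m)
    rwa [hue, pairing_eDual_eVec h2] at this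

/-- Since u' fixes e and moves k^m only by multiples of e, middle components add. Thus N → k^m is a
homomorphism, which transports invariance of measures. -/
lemma midComp_eDual_vecMul_mul (u u' : unipotentRadical S) :
    midComp (eDual k m ᵥ* (u * u').1.1) =
      midComp (eDual k m ᵥ* u'.1.1) + midComp (eDual k m ᵥ* u.1.1) := by
  have e : eDual k m ᵥ* (u * u').1.1 = (eDual k m ᵥ* u.1.1) ᵥ* u'.1.1 := by
    simp [Matrix.vecMul_vecMul]
  rw [e, eDual_vecMul_unipotent h2 u]
  set a := midComp (eDual k m ᵥ* u.1.1)
  obtain ⟨c, hc⟩ := u'.2.2.2 (midEmb a) (by simp [pairing_eq])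
  have he := u'.2.2.1
  unfold cuspVec
  rw [Matrix.add_vecMul, Matrix.add_vecMul, Matrix.smul_vecMul, hc, he]
  simp only [midComp_add, midComp_smul, midComp_midEmb, midComp_eVec, midComp_eDual, smul_zero,
    add_zero, zero_add]

/-- The matrix of `v ↦ v + ⟨v, e⟩ a - ⟨v, a⟩ e - ½ B(a) ⟨v, e⟩ e`. -/
def unipotentMatrix (S : Matrix (Fin m) (Fin m) k) (a : Fin m → k) : Matrix (Idx m) (Idx m) k :=
  1 + Matrix.vecMulVec (gram S *ᵥ eVec k m) (midEmb a + (-(2⁻¹ * quadForm S a)) • eVec k m) -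
    Matrix.vecMulVec (gram S *ᵥ midEmb a) (eVec k m)

omit h2 in
lemma vecMul_unipotentMatrix (a : Fin m → k) (v : Idx m → k) :
    v ᵥ* unipotentMatrix S a = v + (pairing S v (eVec k m) • midEmb a +
      (-(2⁻¹ * quadForm S a) * pairing S v (eVec k m) - pairing S v (midEmb a)) • eVec k m) := by
  have h : ∀ x y : Idx m → k, v ᵥ* Matrix.vecMulVec x y = (v ⬝ᵥ x) • y := by
    intro x y
    rw [Matrix.vecMul_vecMulVec]
  rw [unipotentMatrix, Matrix.vecMul_sub, Matrix.vecMul_add, Matrix.vecMul_one, h, h]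
  unfold pairing
  module

omit h2 in
lemma pairing_eVec_eVec : pairing S (eVec k m) (eVec k m) = 0 := by simp [pairing_eq]
omit h2 in
lemma pairing_eVec_midEmb (a : Fin m → k) : pairing S (eVec k m) (midEmb a) = 0 := by
  simp [pairing_eq]
omit h2 in
lemma pairing_midEmb_eVec (a : Fin m → k) : pairing S (midEmb a) (eVec k m) = 0 := by
  simp [pairing_eq]

omit h2 in
lemma quadForm_neg (a : Fin m → k) : quadForm S (-a) = quadForm S a := by
  simp [quadForm, Matrix.mulVec_neg]

lemma unipotentMatrix_mul_neg (a : Fin m → k) :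
    unipotentMatrix S a * unipotentMatrix S (-a) = 1 := by
  refine Matrix.ext_of_single_vecMul fun i => ?_
  rw [← Matrix.vecMul_vecMul, Matrix.vecMul_one]
  generalize (Pi.single i 1 : Idx m → k) = v
  have hneg : midEmb (-a) = (-1 : k) • midEmb a := by rw [← midEmb_smul]; simp
  rw [vecMul_unipotentMatrix (-a), vecMul_unipotentMatrix a, hneg, quadForm_neg]
  simp only [pairing_add_left, pairing_smul_left, pairing_smul_right, pairing_eVec_eVec,
    pairing_eVec_midEmb, pairing_midEmb_eVec, pairing_midEmb]
  have hq : a ⬝ᵥ (S *ᵥ a) = quadForm S a := rfl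
  rw [hq]
  generalize pairing S v (eVec k m) = x
  generalize pairing S v (midEmb a) = y
  have : (2⁻¹ : k) + 2⁻¹ = 1 := by field_simp; norm_num
  -- In terms of z = ½B(a) the identity no longer involves an inverse of 2.
  have e : quadForm S a = 2⁻¹ * quadForm S a + 2⁻¹ * quadForm S a := by
    rw [← add_mul, this, one_mul]
  generalize hz : 2⁻¹ * quadForm S a = z at *
  rw [e]
  module

/-- Surjectivity of N → k^m; the explicit transvection attached to a is the witness. -/
lemma exists_unipotent (hS : S.IsSymm) (a : Fin m → k) :
    ∃ u : unipotentRadical S, midComp (eDual k m ᵥ* u.1.1) = a := by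
  have hmem : (⟨unipotentMatrix S a, unipotentMatrix S (-a), unipotentMatrix_mul_neg h2 a, by
      simpa using unipotentMatrix_mul_neg (S := S) h2 (-a)⟩ : GL (Idx m) k) ∈
      unipotentRadical S := by
    refine ⟨fun v w => ?_, ?_, fun v hv => ?_⟩
    · simp only [vecMul_unipotentMatrix]
      simp only [pairing_add_left, pairing_smul_left, pairing_add_right, pairing_smul_right,
        pairing_eVec_eVec, pairing_eVec_midEmb, pairing_midEmb_eVec, pairing_midEmb]
      rw [pairing_comm hS (midEmb a) w, pairing_comm hS (eVec k m) w]
      have hq : a ⬝ᵥ (S *ᵥ a) = quadForm S a := rfl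
      rw [hq]
      have : (2⁻¹ : k) + 2⁻¹ = 1 := by field_simp; norm_num
      linear_combination (-(quadForm S a) * pairing S v (eVec k m) * pairing S w (eVec k m)) * this
    · simp only [vecMul_unipotentMatrix]
      simp [pairing_eVec_eVec, pairing_eVec_midEmb]
    · simp only [vecMul_unipotentMatrix]
      exact ⟨-pairing S v (midEmb a), by rw [hv]; simp⟩
  refine ⟨⟨_, hmem⟩, ?_⟩
  simp only [vecMul_unipotentMatrix]
  simp [pairing_eDual_eVec h2]

section Levi

variable (hdet : S.det ≠ 0) {g : GL (Idx m) k} {lam : kˣ} (hg : IsLevi S g lam)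
include hg

omit h2 in
lemma IsLevi.exists_block : ∃ A : Matrix (Fin m) (Fin m) k,
    (∀ a, midEmb a ᵥ* g.1 = midEmb (a ᵥ* A)) ∧ A * S * Aᵀ = S := by
  obtain ⟨ho, -, hb⟩ := hg
  choose b hb using hb
  have hbm : ∀ a, midEmb a ᵥ* g.1 = midEmb (b a) := hb
  have hb' : ∀ a, b a = midComp (midEmb a ᵥ* g.1) := fun a => by rw [hbm]; rfl
  let f : (Fin m → k) →ₗ[k] (Fin m → k) :=
    { toFun := b
      map_add' := fun x y => by
        rw [hb', hb', hb', midEmb_add, Matrix.add_vecMul, midComp_add]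
      map_smul' := fun c x => by
        rw [hb', hb', midEmb_smul, Matrix.smul_vecMul, midComp_smul]; rfl }
  have hf : ∀ a, a ᵥ* (LinearMap.toMatrix' f)ᵀ = b a := by
    intro a
    rw [Matrix.vecMul_transpose, LinearMap.toMatrix'_mulVec]; rfl
  refine ⟨(LinearMap.toMatrix' f)ᵀ, fun a => by rw [hf, hbm], ?_⟩
  set A := (LinearMap.toMatrix' f)ᵀ
  have h : ∀ x y : Fin m → k, x ⬝ᵥ ((A * S * Aᵀ) *ᵥ y) = x ⬝ᵥ (S *ᵥ y) := by
    intro x y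
    have := ho (midEmb x) (midEmb y)
    rw [hbm, hbm, pairing_midEmb, pairing_midEmb, ← hf, ← hf] at this
    rw [← this, ← Matrix.mulVec_mulVec, ← Matrix.mulVec_mulVec, Matrix.mulVec_transpose A y,
      Matrix.dotProduct_mulVec x, Matrix.dotProduct_mulVec]
  ext i j
  simpa using h (Pi.single i 1) (Pi.single j 1)

include hdet in
-- The image of e' is isotropic, pairs to λ with e, and is orthogonal to the image of k^m. That
-- image is all of k^m because A is invertible, so nondegeneracy of S kills the middle component and
-- `eq_cuspVec` determines the rest.
lemma IsLevi.eDual_vecMul {A : Matrix (Fin m) (Fin m) k}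
    (hA : ∀ a, midEmb a ᵥ* g.1 = midEmb (a ᵥ* A)) (hAS : A * S * Aᵀ = S) :
    eDual k m ᵥ* g.1 = (lam : k) • eDual k m := by
  obtain ⟨ho, he, -⟩ := hg
  have hlam : (lam : k) * ((lam⁻¹ : kˣ) : k) = 1 := by simp
  set v := eDual k m ᵥ* g.1 with hv
  have h1 : pairing S v (eVec k m) = lam := by
    have := ho (eDual k m) (eVec k m)
    rw [he, pairing_smul_right, pairing_eDual_eVec h2] at this
    linear_combination (lam : k) * this - pairing S v (eVec k m) * hlam
  have hAu : IsUnit A.det := by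
    have := congrArg Matrix.det hAS
    rw [Matrix.det_mul, Matrix.det_mul, Matrix.det_transpose] at this
    refine isUnit_iff_ne_zero.2 fun h0 => hdet ?_
    rw [← this, h0]; simp
  have h2' : midComp v = 0 := by
    have h3 : ∀ b, midComp v ⬝ᵥ (S *ᵥ b) = 0 := by
      intro b
      have := ho (eDual k m) (midEmb (b ᵥ* A⁻¹))
      rw [hA, Matrix.vecMul_vecMul, Matrix.nonsing_inv_mul _ hAu, Matrix.vecMul_one] at this
      rw [← hv] at this
      simpa [pairing_eq] using this
    rw [← dotProduct_eq_zero_iff]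
    intro w
    have := h3 (S⁻¹ *ᵥ w)
    rwa [Matrix.mulVec_mulVec, Matrix.mul_nonsing_inv _ (isUnit_iff_ne_zero.2 hdet),
      Matrix.one_mulVec] at this
  have h4 : pairing S v v = 0 := by rw [hv, ho, pairing_eDual_eDual]
  have hw : pairing S ((lam⁻¹ : kˣ) • v) ((lam⁻¹ : kˣ) • v) = 0 := by
    simp only [Units.smul_def]
    rw [pairing_smul_left, pairing_smul_right, h4]; simp
  have hw' : pairing S ((lam⁻¹ : kˣ) • v) (eVec k m) = 1 := by
    simp only [Units.smul_def]
    rw [pairing_smul_left, h1]; simp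
  have := eq_cuspVec h2 hw hw'
  have h5 : midComp ((lam⁻¹ : kˣ) • v) = 0 := by
    rw [Units.smul_def, midComp_smul, h2', smul_zero]
  rw [h5, inv_smul_eq_iff] at this
  rw [this, Units.smul_def]
  congr 1
  apply idx_ext <;> simp [cuspVec, quadForm]

end Levi

end Algebra

section Algebra

variable {k : Type*} [Field k] {m : ℕ} {S : Matrix (Fin m) (Fin m) k}

lemma quadForm_smul (c : k) (a : Fin m → k) : quadForm S (c • a) = c ^ 2 * quadForm S a := by
  simp [quadForm, Matrix.mulVec_smul]; ring

lemma quadForm_vecMul {A : Matrix (Fin m) (Fin m) k} (hA : A * S * Aᵀ = S) (a : Fin m → k) :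
    quadForm S (a ᵥ* A) = quadForm S a := by
  unfold quadForm
  conv_rhs => rw [← hA]
  rw [← Matrix.mulVec_mulVec, ← Matrix.mulVec_mulVec, Matrix.mulVec_transpose A a,
    Matrix.dotProduct_mulVec a, Matrix.dotProduct_mulVec]

/-- The image is λe' + aA - (2λ)⁻¹B(a)e. Pulling out λ rescales the middle part to λ⁻¹aA, and the
e-coefficient fits because B(λ⁻¹aA) = λ⁻²B(a). -/
lemma eVec_vecMul_eq (h2 : (2 : k) ≠ 0) (hdet : S.det ≠ 0) {ξ g : GL (Idx m) k} {lam : kˣ}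
    (hξ : IsLongWeyl S ξ) (hg : IsLevi S g lam) {A : Matrix (Fin m) (Fin m) k}
    (hA : ∀ a, midEmb a ᵥ* g.1 = midEmb (a ᵥ* A)) (hAS : A * S * Aᵀ = S)
    (u : unipotentRadical S) :
    eVec k m ᵥ* (ξ * u.1 * g).1 = (lam : k) • cuspVec S
      ((lam : k)⁻¹ • (midComp (eDual k m ᵥ* u.1.1) ᵥ* A)) := by
  have e : eVec k m ᵥ* (ξ * u.1 * g).1 = ((eVec k m ᵥ* ξ.1) ᵥ* u.1.1) ᵥ* g.1 := by
    simp [Matrix.vecMul_vecMul, mul_assoc]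
  have hu := eDual_vecMul_unipotent h2 u
  obtain ⟨a, ha⟩ : ∃ a, midComp (eDual k m ᵥ* u.1.1) = a := ⟨_, rfl⟩
  rw [ha] at hu ⊢
  rw [e, hξ.2.1, hu, cuspVec, cuspVec, Matrix.add_vecMul, Matrix.add_vecMul, Matrix.smul_vecMul, hA,
    hg.eDual_vecMul h2 hdet hA hAS, hg.2.1, quadForm_smul, quadForm_vecMul hAS, midEmb_smul]
  simp only [smul_add, smul_smul, mul_inv_cancel₀ lam.ne_zero, one_smul, Units.val_inv_eq_inv_val]
  congr 2
  have := lam.ne_zero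
  field_simp

end Algebra

/-! ### The height max(1, |a|, |B(a)|) and its sublevel sets. -/

section Radius

variable {k : Type*} [NontriviallyNormedField k] {m : ℕ}

/-- `max(1, |a|, |B(a)|)`. -/
noncomputable def radius (S : Matrix (Fin m) (Fin m) k) (a : Fin m → k) : ℝ :=
  max 1 (max ‖a‖ ‖quadForm S a‖)

variable {S : Matrix (Fin m) (Fin m) k}

lemma continuous_quadForm : Continuous (quadForm S) := by
  unfold quadForm; fun_prop

/-- The outer coordinates are ½(±1 - B(a)). Their difference is 1 and their sum -B(a), so with |2| =
1 and the ultrametric inequality they have the same maximum as 1 and B(a). -/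
lemma forall_norm_mul_cuspVec_le_iff [IsUltrametricDist k] (h2 : ‖(2 : k)‖ = 1) (t : k)
    (a : Fin m → k) :
    (∀ i, ‖t * cuspVec S a i‖ ≤ 1) ↔ ‖t‖ * radius S a ≤ 1 := by
  have h20 : (2 : k) ≠ 0 := norm_ne_zero_iff.1 (by rw [h2]; exact one_ne_zero)
  have h2i : ‖(2⁻¹ : k)‖ = 1 := by rw [norm_inv, h2, inv_one]
  have e1 : cuspVec S a (Sum.inl ()) = 2⁻¹ * (1 - quadForm S a) := by simp [cuspVec]; ring
  have e3 : cuspVec S a (Sum.inr (Sum.inr ())) = 2⁻¹ * (-1 - quadForm S a) := by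
    simp [cuspVec]; ring
  have e2 : ∀ i, cuspVec S a (Sum.inr (Sum.inl i)) = a i := fun i => by
    simp [cuspVec, eDual, eVec, midEmb]
  have hR : ‖t‖ * radius S a ≤ 1 ↔ ‖t‖ ≤ 1 ∧ (∀ i, ‖t * a i‖ ≤ 1) ∧ ‖t * quadForm S a‖ ≤ 1 := by
    rw [radius, mul_max_of_nonneg _ _ (norm_nonneg t), mul_max_of_nonneg _ _ (norm_nonneg t),
      max_le_iff, max_le_iff, mul_one, ← norm_smul, pi_norm_le_iff_of_nonneg zero_le_one, norm_mul]
    rfl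
  rw [hR]
  constructor
  · intro h
    have h1 := h (Sum.inl ())
    have h3 := h (Sum.inr (Sum.inr ()))
    rw [e1] at h1
    rw [e3] at h3
    refine ⟨?_, fun i => by simpa [e2] using h (Sum.inr (Sum.inl i)), ?_⟩
    · have : t = t * (2⁻¹ * (1 - quadForm S a)) + -(t * (2⁻¹ * (-1 - quadForm S a))) := by
        field_simp; ring
      rw [this]
      exact (IsUltrametricDist.norm_add_le_max _ _).trans (max_le h1 (by rwa [norm_neg]))
    · have : t * quadForm S a = -(t * (2⁻¹ * (1 - quadForm S a)) +
          t * (2⁻¹ * (-1 - quadForm S a))) := by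
        field_simp; ring
      rw [this, norm_neg]
      exact (IsUltrametricDist.norm_add_le_max _ _).trans (max_le h1 h3)
  · rintro ⟨ht, ha, hB⟩ i
    rcases i with ⟨⟩ | i | ⟨⟩
    · rw [e1, mul_left_comm, norm_mul, h2i, one_mul, mul_sub, mul_one, sub_eq_add_neg]
      exact (IsUltrametricDist.norm_add_le_max _ _).trans (max_le ht (by rwa [norm_neg]))
    · rw [e2]; exact ha i
    · rw [e3, mul_left_comm, norm_mul, h2i, one_mul, mul_sub, sub_eq_add_neg]
      exact (IsUltrametricDist.norm_add_le_max _ _).trans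
        (max_le (by simpa using ht) (by rwa [norm_neg]))

lemma exists_radius_eq_pow [IsUltrametricDist k] [ProperSpace k]
    (hk : ∀ ϖ : 𝒪[k], Irreducible ϖ → ‖(ϖ : k)‖ = ((OrthConst.residueCard k : ℕ) : ℝ)⁻¹)
    (a : Fin m → k) : ∃ j : ℕ, radius S a = (residueCard k : ℝ) ^ j := by
  have hq : (1 : ℝ) < residueCard k := by exact_mod_cast one_lt_residueCard hk
  have hx : ∃ x : k, ‖x‖ = ‖a‖ := by
    rcases isEmpty_or_nonempty (Fin m) with h | h
    · exact ⟨0, by rw [Subsingleton.elim a 0]; simp⟩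
    · obtain ⟨i, -, hi⟩ := Finset.exists_mem_eq_sup Finset.univ Finset.univ_nonempty
        (fun i => ‖a i‖₊)
      exact ⟨a i, by rw [Pi.norm_def, hi]; rfl⟩
  obtain ⟨x, hx⟩ := hx
  -- The maximum is attained, so the height lies in the value group; being at least 1, it is a
  -- nonnegative power of q.
  have hz : ∃ z : k, ‖z‖ = radius S a := by
    unfold radius
    rw [← hx]
    rcases max_choice ‖x‖ ‖quadForm S a‖ with h | h <;> rw [h]
    · rcases max_choice 1 ‖x‖ with h | h <;> rw [h]
      · exact ⟨1, norm_one⟩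
      · exact ⟨x, rfl⟩
    · rcases max_choice 1 ‖quadForm S a‖ with h | h <;> rw [h]
      · exact ⟨1, norm_one⟩
      · exact ⟨_, rfl⟩
  obtain ⟨z, hz⟩ := hz
  have h1 : 1 ≤ ‖z‖ := hz ▸ le_max_left _ _
  obtain ⟨j, hj⟩ := exists_norm_eq_zpow hk (norm_pos_iff.1 (one_pos.trans_le h1))
  have hj0 : 0 ≤ j := by
    by_contra hc
    have := zpow_lt_one_of_neg₀ hq (not_le.1 hc)
    linarith
  obtain ⟨i, rfl⟩ := Int.eq_ofNat_of_zero_le hj0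
  exact ⟨i, by rw [← hz, hj, zpow_natCast]⟩

variable [ProperSpace k] [MeasurableSpace k] [BorelSpace k]

/-- Dilation by ϖ^l maps the sublevel set onto the set measured by X_l(0), with Jacobian q^{-ml}. -/
lemma measure_radius_le [IsUltrametricDist k]
    (hk : ∀ ϖ : 𝒪[k], Irreducible ϖ → ‖(ϖ : k)‖ = ((OrthConst.residueCard k : ℕ) : ℝ)⁻¹)
    (ν : Measure k) [ν.IsAddHaarMeasure] (l : ℕ) :
    (Measure.pi fun _ : Fin m => ν).real {a | radius S a ≤ (residueCard k : ℝ) ^ l} =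
      ((residueCard k : ℝ) ^ m) ^ l * congrMeas ν S 0 l := by
  have hq : (1 : ℝ) < residueCard k := by exact_mod_cast one_lt_residueCard hk
  have hq0 : (0 : ℝ) < residueCard k := one_pos.trans hq
  obtain ⟨ϖ, hϖ⟩ := exists_norm_eq_inv_residueCard hk
  set c : k := (ϖ : k) ^ l with hc
  have hcn : ‖c‖ = ((residueCard k : ℝ) ^ l)⁻¹ := by rw [hc, norm_pow, hϖ, inv_pow]
  have hc0 : c ≠ 0 := pow_ne_zero _ ϖ.ne_zero
  have hql : 0 < (residueCard k : ℝ) ^ l := by positivity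
  set E : Set (Fin m → k) :=
    {a | (∀ i, a i ∈ 𝒪[k]) ∧ ∃ y : 𝒪[k], y ∈ 𝓂[k] ^ l ∧ quadForm S a - 0 = (y : k)}
  have hE : E = {a | ‖a‖ ≤ 1 ∧ ‖quadForm S a‖ ≤ ((residueCard k : ℝ) ^ l)⁻¹} := by
    ext a
    simp only [E, Set.mem_ofPred_eq, sub_zero, pi_norm_le_iff_of_nonneg zero_le_one,
      Valued.integer.mem_iff, mem_maximalIdeal_pow_iff hk]
    refine and_congr_right fun _ => ⟨?_, fun h => ?_⟩
    · rintro ⟨y, hy, e⟩; rwa [e]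
    · exact ⟨⟨quadForm S a, Valued.integer.mem_iff.2
        (h.trans (inv_le_one_of_one_le₀ (one_le_pow₀ hq.le)))⟩, h, rfl⟩
  have hEm : MeasurableSet E := by
    rw [hE]
    exact (measurableSet_le continuous_norm.measurable measurable_const).inter
      (measurableSet_le (continuous_norm.comp continuous_quadForm).measurable measurable_const)
  have hpre : {a | radius S a ≤ (residueCard k : ℝ) ^ l} =
      Matrix.toLin' (c • (1 : Matrix (Fin m) (Fin m) k)) ⁻¹' E := by
    ext a
    have ha : Matrix.toLin' (c • (1 : Matrix (Fin m) (Fin m) k)) a = c • a := by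
      simp
    rw [Set.mem_preimage, ha, hE]
    simp only [Set.mem_ofPred_eq, radius, max_le_iff, quadForm_smul, norm_smul, norm_mul,
      norm_pow, hcn]
    -- B scales by q^{-2l}; one factor q^{-l} absorbs the bound q^l, the other is the congruence
    -- modulo ϖ^l.
    rw [and_iff_right (one_le_pow₀ hq.le), inv_mul_le_one₀ hql, sq, mul_assoc,
      mul_le_iff_le_one_right (inv_pos.2 hql), inv_mul_le_one₀ hql]
  have hm : Measurable (Matrix.toLin' (c • (1 : Matrix (Fin m) (Fin m) k))) :=
    (LinearMap.continuous_on_pi _).measurable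
  have hd : (c • (1 : Matrix (Fin m) (Fin m) k)).det = c ^ m := by simp
  rw [hpre, measureReal_def, ← Measure.map_apply hm hEm,
    map_matrix_pi hk ν (by rw [hd]; exact pow_ne_zero _ hc0), hd, Measure.smul_apply,
    smul_eq_mul, ENNReal.toReal_mul, ENNReal.toReal_ofReal (by positivity), norm_pow, hcn,
    inv_pow, inv_inv, ← pow_mul, ← pow_mul, mul_comm l m]
  rfl

/-- The pushforward under a continuous surjective homomorphism is translation invariant. Both
measures give the unit ball mass 1, so uniqueness of Haar measure applies; injectivity plays no
role. -/
lemma map_midComp_unipotent (h2 : ‖(2 : k)‖ = 1) (hS : S.IsSymm)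
    (ν : Measure k) [ν.IsAddHaarMeasure] (hν : ν {x | ‖x‖ ≤ 1} = 1)
    [MeasurableSpace (unipotentRadical S)] [BorelSpace (unipotentRadical S)]
    (μ : Measure (unipotentRadical S)) [μ.IsHaarMeasure]
    (hμ : μ {u | ∀ i : Fin m, ‖(eDual k m ᵥ* u.1.1) (Sum.inr (Sum.inl i))‖ ≤ 1} = 1) :
    MeasurePreserving (fun u : unipotentRadical S => midComp (eDual k m ᵥ* u.1.1)) μ
      (Measure.pi fun _ : Fin m => ν) := by
  have h20 : (2 : k) ≠ 0 := norm_ne_zero_iff.1 (by rw [h2]; exact one_ne_zero)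
  set f : unipotentRadical S → Fin m → k := fun u => midComp (eDual k m ᵥ* u.1.1) with hf
  have hcont : Continuous f := by
    have h1 : Continuous fun u : unipotentRadical S => u.1.1 :=
      Units.continuous_val.comp continuous_subtype_val
    have h3 : Continuous fun u : unipotentRadical S => eDual k m ᵥ* u.1.1 :=
      continuous_const.matrix_vecMul h1
    exact continuous_pi fun i => (continuous_apply _).comp h3
  refine ⟨hcont.measurable, ?_⟩
  have hinv : (μ.map f).IsAddLeftInvariant := by
    refine ⟨fun b => ?_⟩
    obtain ⟨u, hu⟩ := exists_unipotent h20 hS b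
    rw [Measure.map_map (measurable_const_add b) hcont.measurable]
    have : (fun x => b + x) ∘ f = f ∘ fun u' => u * u' := by
      funext u'
      simp only [Function.comp, hf]
      rw [midComp_eDual_vecMul_mul h20, hu, add_comm]
    rw [this, ← Measure.map_map hcont.measurable (measurable_const_mul u), map_mul_left_eq_self]
  have hball : ∀ a : Fin m → k, a ∈ Metric.closedBall (0 : Fin m → k) 1 ↔ ∀ i, ‖a i‖ ≤ 1 := by
    intro a
    rw [mem_closedBall_zero_iff, pi_norm_le_iff_of_nonneg zero_le_one]
  have hone : μ.map f (Metric.closedBall 0 1) = 1 := by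
    rw [Measure.map_apply hcont.measurable Metric.isClosed_closedBall.measurableSet, ← hμ]
    congr 1
    ext u
    exact hball _
  have hpi : (Measure.pi fun _ : Fin m => ν) (Metric.closedBall 0 1) = 1 := by
    have : Metric.closedBall (0 : Fin m → k) 1 = Set.univ.pi fun _ => {x | ‖x‖ ≤ 1} := by
      ext a; rw [hball]; simp
    rw [this, Measure.pi_pi]
    simp [hν]
  -- Not automatic for a pushforward; for an invariant measure, one set of finite mass with nonempty
  -- interior suffices.
  have hfin : IsFiniteMeasureOnCompacts (μ.map f) := by
    refine ⟨fun K hK => ?_⟩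
    refine measure_lt_top_of_isCompact_of_isAddLeftInvariant' (U := Metric.closedBall 0 1) ?_ ?_ hK
    · exact ⟨0, Metric.ball_subset_interior_closedBall (Metric.mem_ball_self one_pos)⟩
    · rw [hone]; exact ENNReal.one_ne_top
  have hsm := Measure.isAddLeftInvariant_eq_smul (μ.map f) (Measure.pi fun _ : Fin m => ν)
  have h1 := congrArg (fun ρ : Measure (Fin m → k) => ρ (Metric.closedBall 0 1)) hsm
  simp only [hone, Measure.smul_apply, hpi] at h1
  have hc : Measure.addHaarScalarFactor (μ.map f) (Measure.pi fun _ : Fin m => ν) = 1 := by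
    have h3 : ((Measure.addHaarScalarFactor (μ.map f) (Measure.pi fun _ : Fin m => ν) : NNReal) :
        ENNReal) = 1 := by
      rw [h1, ENNReal.smul_def, smul_eq_mul, mul_one]
    exact_mod_cast h3
  rw [hsm, hc, one_smul]

end Radius

/-! ### Values of the spherical function and the change of variables. -/

section Spherical

variable {k : Type*} [NontriviallyNormedField k] [IsUltrametricDist k] [ProperSpace k]
  [MeasurableSpace k] [BorelSpace k] {m : ℕ} {S : Matrix (Fin m) (Fin m) k}

omit [MeasurableSpace k] [BorelSpace k] in
lemma localZeta_ne_zero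
    (hk : ∀ ϖ : 𝒪[k], Irreducible ϖ → ‖(ϖ : k)‖ = ((OrthConst.residueCard k : ℕ) : ℝ)⁻¹)
    {α : ℂ} (hα : 0 < α.re) : localZeta k α ≠ 0 := by
  have hw := norm_natCast_cpow_neg_lt_one (one_lt_residueCard hk) hα
  have h1 : 1 - (residueCard k : ℂ) ^ (-α) ≠ 0 := sub_ne_zero.2 fun h => by
    rw [← h] at hw; simp at hw
  exact one_div_ne_zero h1

lemma sphericalInt_one
    (hk : ∀ ϖ : 𝒪[k], Irreducible ϖ → ‖(ϖ : k)‖ = ((OrthConst.residueCard k : ℕ) : ℝ)⁻¹)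
    (τ : Measure kˣ) [τ.IsHaarMeasure] (hτ : τ {t | ‖(t : k)‖ = 1} = 1)
    {α : ℂ} (hα : 0 < α.re) : sphericalInt τ α (1 : GL (Idx m) k) = localZeta k α := by
  rw [sphericalInt_eq hk τ hτ hα 1 1]
  · simp
  · intro t
    simp only [Units.val_one, Matrix.vecMul_one, mul_one]
    constructor
    · intro h; simpa using h (Sum.inl ())
    · rintro h (⟨⟩ | i | ⟨⟩) <;> simp [eVec, h]

lemma spherical_eq
    (hk : ∀ ϖ : 𝒪[k], Irreducible ϖ → ‖(ϖ : k)‖ = ((OrthConst.residueCard k : ℕ) : ℝ)⁻¹)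
    (h2 : ‖(2 : k)‖ = 1)
    (τ : Measure kˣ) [τ.IsHaarMeasure] (hτ : τ {t | ‖(t : k)‖ = 1} = 1)
    {α : ℂ} (hα : 0 < α.re) (g : GL (Idx m) k) (lam : kˣ) (a : Fin m → k)
    (hg : eVec k m ᵥ* g.1 = (lam : k) • cuspVec S a) {j : ℕ}
    (hj : radius S a = (residueCard k : ℝ) ^ j) :
    spherical τ α g = ((‖(lam : k)‖ : ℝ) : ℂ) ^ (-α) * ((residueCard k : ℂ) ^ (-α)) ^ j := by
  have hq0 : (0 : ℝ) < residueCard k := by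
    exact_mod_cast (one_lt_residueCard hk).trans' one_pos
  obtain ⟨ϖ, hϖ⟩ := exists_norm_eq_inv_residueCard hk
  -- The scalar λϖ^{-j} realizes the sup norm |λ|·`radius S a` of e·g.
  have hc : ‖((lam * (ϖ⁻¹) ^ j : kˣ) : k)‖ = ‖(lam : k)‖ * (residueCard k : ℝ) ^ (j : ℤ) := by
    simp [hϖ]
  rw [spherical, sphericalInt_one hk τ hτ hα, sphericalInt_eq hk τ hτ hα g (lam * (ϖ⁻¹) ^ j),
    mul_div_cancel_right₀ _ (localZeta_ne_zero hk hα), hc, Complex.ofReal_mul,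
    Complex.mul_cpow_ofReal_nonneg (norm_nonneg _) (by positivity), ofReal_zpow_cpow hq0,
    zpow_natCast, Complex.ofReal_natCast]
  intro t
  rw [norm_mul, hc, zpow_natCast, ← hj, ← mul_assoc, ← norm_mul,
    ← forall_norm_mul_cuspVec_le_iff h2]
  simp [hg, mul_assoc]

lemma measurable_of_radius_eq_pow
    (hk : ∀ ϖ : 𝒪[k], Irreducible ϖ → ‖(ϖ : k)‖ = ((OrthConst.residueCard k : ℕ) : ℝ)⁻¹)
    {R : (Fin m → k) → ℕ} (hR : ∀ a, radius S a = (residueCard k : ℝ) ^ R a) :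
    Measurable R ∧ ∀ l, {a | R a ≤ l} = {a | radius S a ≤ (residueCard k : ℝ) ^ l} := by
  have hq : (1 : ℝ) < residueCard k := by exact_mod_cast one_lt_residueCard hk
  have hset : ∀ l, {a | R a ≤ l} = {a | radius S a ≤ (residueCard k : ℝ) ^ l} := by
    intro l
    ext a
    simp only [Set.mem_ofPred_eq, hR, pow_le_pow_iff_right₀ hq]
  refine ⟨measurable_of_Iic fun l => ?_, hset⟩
  have : R ⁻¹' Set.Iic l = {a | R a ≤ l} := rfl
  rw [this, hset]
  refine measurableSet_le (Continuous.measurable ?_) measurable_const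
  have := continuous_quadForm (S := S)
  unfold radius
  fun_prop

omit [BorelSpace k] in
-- Each X_l(ρ) is at most vol(𝒪^m) = 1, so a geometric series dominates.
lemma summable_congrTerm
    (hk : ∀ ϖ : 𝒪[k], Irreducible ϖ → ‖(ϖ : k)‖ = ((OrthConst.residueCard k : ℕ) : ℝ)⁻¹)
    (ν : Measure k) [ν.IsAddHaarMeasure] (hν : ν {x | ‖x‖ ≤ 1} = 1) {β : ℂ} (hβ : 0 < β.re)
    (ρ : k) : Summable (congrTerm ν S β ρ) := by
  have hw := norm_natCast_cpow_neg_lt_one (one_lt_residueCard hk) hβ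
  refine (summable_geometric_of_lt_one (norm_nonneg _) hw).of_norm_bounded fun l => ?_
  have hpi : (Measure.pi fun _ : Fin m => ν) (Set.univ.pi fun _ => {x | ‖x‖ ≤ 1}) = 1 := by
    rw [Measure.pi_pi]; simp [hν]
  have hle : congrMeas ν S ρ l ≤ 1 := by
    unfold congrMeas
    refine (measureReal_mono (fun a ha => ?_) (by rw [hpi]; exact ENNReal.one_ne_top)).trans_eq
      (show (Measure.pi fun _ : Fin m => ν).real (Set.univ.pi fun _ => {x | ‖x‖ ≤ 1}) = 1 by
        rw [measureReal_def, hpi, ENNReal.toReal_one])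
    exact fun i _ => Valued.integer.mem_iff.1 (ha.1 i)
  rw [congrTerm, norm_mul, norm_pow, Complex.norm_real, Real.norm_of_nonneg (show 0 ≤ congrMeas ν S ρ l from measureReal_nonneg)]
  exact mul_le_of_le_one_right (by positivity) hle

/-- Taking determinants in ASAᵗ = S gives |det A| = 1; only the scalar λ⁻¹ changes volume. -/
lemma measurePreserving_block
    (hk : ∀ ϖ : 𝒪[k], Irreducible ϖ → ‖(ϖ : k)‖ = ((OrthConst.residueCard k : ℕ) : ℝ)⁻¹)
    (ν : Measure k) [ν.IsAddHaarMeasure] (hdet : ‖S.det‖ = 1) {A : Matrix (Fin m) (Fin m) k}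
    (hAS : A * S * Aᵀ = S) (lam : kˣ) :
    MeasurePreserving (fun a : Fin m → k => (lam : k)⁻¹ • (a ᵥ* A)) (Measure.pi fun _ => ν)
      (ENNReal.ofReal (‖(lam : k)‖ ^ m) • Measure.pi fun _ => ν) := by
  have hf : (fun a : Fin m → k => (lam : k)⁻¹ • (a ᵥ* A)) =
      Matrix.toLin' ((lam : k)⁻¹ • Aᵀ) := by
    funext a
    rw [Matrix.toLin'_apply, Matrix.smul_mulVec, Matrix.mulVec_transpose]
  have hA : ‖A.det‖ = 1 := by
    have := congrArg (fun B => ‖Matrix.det B‖) hAS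
    simp only [Matrix.det_mul, Matrix.det_transpose, norm_mul, hdet, mul_one] at this
    exact (mul_self_eq_one_iff.1 this).resolve_right (by linarith [norm_nonneg A.det])
  have hn : ‖((lam : k)⁻¹ • Aᵀ).det‖ = (‖(lam : k)‖ ^ m)⁻¹ := by
    rw [Matrix.det_smul, Matrix.det_transpose, norm_mul, hA]; simp
  have h0 : ((lam : k)⁻¹ • Aᵀ).det ≠ 0 := by
    rw [← norm_ne_zero_iff, hn]
    exact inv_ne_zero (pow_ne_zero _ (norm_ne_zero_iff.2 lam.ne_zero))
  rw [hf]
  exact ⟨(LinearMap.continuous_on_pi _).measurable, by rw [map_matrix_pi hk ν h0, hn, inv_inv]⟩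

end Spherical

end OrthConst

/-! ### The constant term. -/

theorem mainTheorem10
    {k : Type*} [NontriviallyNormedField k] [IsUltrametricDist k] [ProperSpace k]
    [MeasurableSpace k] [BorelSpace k]
    -- the absolute value is the normalized one
    (hk : ∀ ϖ : 𝒪[k], Irreducible ϖ → ‖(ϖ : k)‖ = ((OrthConst.residueCard k : ℕ) : ℝ)⁻¹)
    -- the place is good
    (h2 : ‖(2 : k)‖ = 1)
    (n : ℕ) (S : Matrix (Fin (n + 1)) (Fin (n + 1)) k) (hS : S.IsSymm) (hdet : ‖S.det‖ = 1)
    -- Haar measures on `k`, `kˣ` and `N`, normalized on `𝒪`, on `𝒪ˣ`, and on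
    -- the set of `u ∈ N` such that the `k^{n+1}`-component of `e' · u` lies in `𝒪^{n+1}`
    (ν : Measure k) [ν.IsAddHaarMeasure] (hν : ν {x | ‖x‖ ≤ 1} = 1)
    (τ : Measure kˣ) [τ.IsHaarMeasure] (hτ : τ {t | ‖(t : k)‖ = 1} = 1)
    [MeasurableSpace (OrthConst.unipotentRadical S)] [BorelSpace (OrthConst.unipotentRadical S)]
    (μ : Measure (OrthConst.unipotentRadical S)) [μ.IsHaarMeasure]
    (hμ : μ {u | ∀ i : Fin (n + 1),
      ‖(OrthConst.eDual k (n + 1) ᵥ* u.1.1) (Sum.inr (Sum.inl i))‖ ≤ 1} = 1)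
    (s : ℂ) (hs : 0 < s.re)
    (ξ : GL (OrthConst.Idx (n + 1)) k) (hξ : OrthConst.IsLongWeyl S ξ)
    (g : GL (OrthConst.Idx (n + 1)) k) (lam : kˣ) (hg : OrthConst.IsLevi S g lam) :
    (1 < s.re →
      Integrable (fun u : OrthConst.unipotentRadical S =>
        OrthConst.spherical τ (((n : ℂ) + 1) * s) (ξ * u.1 * g)) μ) ∧
    (Integrable (fun u : OrthConst.unipotentRadical S =>
        OrthConst.spherical τ (((n : ℂ) + 1) * s) (ξ * u.1 * g)) μ ↔
      Summable (OrthConst.congrTerm ν S (-(((n : ℂ) + 1) * (1 - s))) 0)) ∧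
    (Integrable (fun u : OrthConst.unipotentRadical S =>
        OrthConst.spherical τ (((n : ℂ) + 1) * s) (ξ * u.1 * g)) μ →
      ∫ u : OrthConst.unipotentRadical S,
          OrthConst.spherical τ (((n : ℂ) + 1) * s) (ξ * u.1 * g) ∂μ =
        ((‖(lam : k)‖ : ℝ) : ℂ) ^ (((n : ℂ) + 1) * (1 - s)) *
          OrthConst.congrSeries ν S (-(((n : ℂ) + 1) * (1 - s))) 0 /
            OrthConst.localZeta k (((n : ℂ) + 1) * s)) := by
  have h20 : (2 : k) ≠ 0 := norm_ne_zero_iff.1 (by rw [h2]; exact one_ne_zero)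
  have hdet0 : S.det ≠ 0 := norm_ne_zero_iff.1 (by rw [hdet]; exact one_ne_zero)
  have hq1 := OrthConst.one_lt_residueCard hk
  have hq : (OrthConst.residueCard k : ℂ) ≠ 0 := by exact_mod_cast (hq1.trans' one_pos).ne'
  set α : ℂ := ((n : ℂ) + 1) * s with hα_def
  set β : ℂ := ((n : ℂ) + 1) * (1 - s) with hβ_def
  have hα : 0 < α.re := by
    have : α.re = ((n : ℝ) + 1) * s.re := by simp [hα_def]
    rw [this]; positivity
  set w : ℂ := (OrthConst.residueCard k : ℂ) ^ (-α) with hw_def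
  have hw : ‖w‖ < 1 := OrthConst.norm_natCast_cpow_neg_lt_one hq1 hα
  choose R hR using OrthConst.exists_radius_eq_pow (S := S) hk
  obtain ⟨hRm, hRset⟩ := OrthConst.measurable_of_radius_eq_pow hk hR
  obtain ⟨A, hA, hAS⟩ := hg.exists_block
  set ρ : Measure (Fin (n + 1) → k) := Measure.pi fun _ => ν
  set C : ℂ := ((‖(lam : k)‖ : ℝ) : ℂ) ^ (-α) with hC_def
  have hlam0 : ((‖(lam : k)‖ : ℝ) : ℂ) ≠ 0 := by simp
  have hC : C ≠ 0 := by simp [hC_def, Complex.cpow_eq_zero_iff]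
  set T : OrthConst.unipotentRadical S → Fin (n + 1) → k := fun u =>
    (lam : k)⁻¹ • (OrthConst.midComp (OrthConst.eDual k (n + 1) ᵥ* u.1.1) ᵥ* A)
  have hT : MeasurePreserving T μ (ENNReal.ofReal (‖(lam : k)‖ ^ (n + 1)) • ρ) :=
    (OrthConst.measurePreserving_block hk ν hdet hAS lam).comp
      (OrthConst.map_midComp_unipotent h2 hS ν hν μ hμ)
  have hval : (fun u : OrthConst.unipotentRadical S => OrthConst.spherical τ α (ξ * u.1 * g)) =
      fun u => C * w ^ R (T u) := by
    funext u
    exact OrthConst.spherical_eq hk h2 τ hτ hα _ lam (T u)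
      (OrthConst.eVec_vecMul_eq h20 hdet0 hξ hg hA hAS u) (hR _)
  have hwm : Measurable fun a => w ^ R a := (measurable_from_nat (f := fun j => w ^ j)).comp hRm
  have hfin : ∀ l : ℕ, ρ {a | R a ≤ l} ≠ ⊤ := by
    intro l
    have hb : Bornology.IsBounded {a | R a ≤ l} := by
      refine (Metric.isBounded_closedBall (x := (0 : Fin (n + 1) → k))
        (r := (OrthConst.residueCard k : ℝ) ^ l)).subset fun a ha => ?_
      rw [hRset] at ha
      rw [mem_closedBall_zero_iff]
      exact ((le_max_left _ _).trans (le_max_right _ _)).trans ha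
    exact hb.measure_lt_top.ne
  have hterm : ∀ l : ℕ, w ^ l * (ρ.real {a | R a ≤ l} : ℂ) =
      OrthConst.congrTerm ν S (-β) 0 l := by
    intro l
    rw [hRset, OrthConst.measure_radius_le hk ν l, OrthConst.congrTerm, neg_neg]
    -- The dilation factor q^{n+1} shifts the exponent from -α to (n+1) - α = β.
    have : (OrthConst.residueCard k : ℂ) ^ β = w * (OrthConst.residueCard k : ℂ) ^ (n + 1) := by
      rw [hw_def, ← Complex.cpow_natCast, ← Complex.cpow_add _ _ hq]
      congr 1
      rw [hα_def, hβ_def]; push_cast; ring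
    rw [this]; push_cast; ring
  have hsum : Integrable (fun u : OrthConst.unipotentRadical S =>
      OrthConst.spherical τ α (ξ * u.1 * g)) μ ↔ Summable (OrthConst.congrTerm ν S (-β) 0) := by
    rw [hval, integrable_const_mul_iff (isUnit_iff_ne_zero.2 hC)]
    have h1 := hT.integrable_comp (g := fun a => w ^ R a) hwm.aestronglyMeasurable
    have h3 : Integrable (fun u => w ^ R (T u)) μ ↔ Integrable (fun a => w ^ R a) ρ := by
      refine h1.trans (integrable_smul_measure ?_ ENNReal.ofReal_ne_top)
      simp
    rw [h3, OrthConst.integrable_pow_iff_summable ρ hRm hw hfin]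
    exact summable_congr hterm
  refine ⟨fun hs1 => hsum.2 (OrthConst.summable_congrTerm hk ν hν ?_ 0), hsum, fun hint => ?_⟩
  · have : (-β).re = ((n : ℝ) + 1) * (s.re - 1) := by simp [hβ_def]; ring
    rw [this]
    exact mul_pos (by positivity) (by linarith)
  · have hs' := (summable_congr hterm).2 (hsum.1 hint)
    rw [hval, integral_const_mul]
    have h1 : ∫ u, w ^ R (T u) ∂μ =
        ∫ a, w ^ R a ∂(ENNReal.ofReal (‖(lam : k)‖ ^ (n + 1)) • ρ) := by
      rw [← hT.map_eq, integral_map hT.measurable.aemeasurable hwm.aestronglyMeasurable]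
    rw [h1, integral_smul_measure, OrthConst.integral_pow_eq_tsum ρ hRm hw hfin hs',
      tsum_congr hterm, ENNReal.toReal_ofReal (by positivity), Complex.real_smul]
    -- One factor comes from the spherical function, the other from the change of variables.
    have hl : ((‖(lam : k)‖ : ℝ) : ℂ) ^ β = C * ((‖(lam : k)‖ : ℝ) : ℂ) ^ (n + 1) := by
      rw [hC_def, ← Complex.cpow_natCast, ← Complex.cpow_add _ _ hlam0]
      congr 1
      rw [hα_def, hβ_def]; push_cast; ring
    rw [OrthConst.localZeta, OrthConst.congrSeries, hl, div_div_eq_mul_div, div_one]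
    push_cast
    ring
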